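/- Let $n\ge 2$, let $\mathfrak{gl}_n=\mathfrak{gl}_n(\mathbb{C})$ with matrix units $E_{ij}$, let $\mathfrak{gl}_{n-1}\subset\mathfrak{gl}_n$ be spanned by the $E_{ij}$ with $1\le i,j\le n-1$, and let $\mathfrak{h}$ be the diagonal Cartan subalgebra of $\mathfrak{gl}_{n-1}$. Let $\mathrm{R}(\mathfrak{h})$ be the field of fractions of $\mathrm{U}(\mathfrak{h})$, let $\mathrm{U}'(\mathfrak{gl}_n)=\mathrm{U}(\mathfrak{gl}_n)\otimes_{\mathrm{U}(\mathfrak{h})}\mathrm{R}(\mathfrak{h})$ (the ring of fractions of $\mathrm{U}(\mathfrak{gl}_n)$ with denominators in $\mathrm{U}(\mathfrak{h})\setminus\{0\}$), and let $\mathrm{J}'$ be the left ideal of $\mathrm{U}'(\mathfrak{gl}_n)$ generated by the $E_{ij}$ with $1\le i<j\le n-1$. The Mickelsson–Zhelobenko algebra is $$\mathrm{Z}(\mathfrak{gl}_n,\mathfrak{gl}_{n-1})=\mathrm{Norm}\,\mathrm{J}'/\mathrm{J}',\qquad \mathrm{Norm}\,\mathrm{J}'=\{u\in\mathrm{U}'(\mathfrak{gl}_n)\mid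 \mathrm{J}'u\subseteq\mathrm{J}'\}.$$ Put $h_i=E_{ii}-i+1$ for $1\le i\le n$. For $i=1,\dots,n-1$ define the raising and lowering operators $$z_{in}=\sum_{i>i_1>\cdots>i_s\ge 1}E_{ii_1}E_{i_1i_2}\cdots E_{i_{s-1}i_s}E_{i_sn}\,(h_i-h_{j_1})\cdots(h_i-h_{j_r}),$$ $$z_{ni}=\sum_{i<i_1<\cdots<i_s<n}E_{i_1i}E_{i_2i_1}\cdots E_{i_si_{s-1}}E_{ni_s}\,(h_i-h_{j_1})\cdots(h_i-h_{j_r}),$$ where $s$ runs over the nonnegative integers and $\{j_1,\dots,j_r\}$ is the complement of $\{i_1,\dots,i_s\}$ in $\{1,\dots,i-1\}$, respectively in $\{i+1,\dots,n-1\}$. Then $z_{in}$ and $z_{ni}$ lie in $\mathrm{Norm}\,\mathrm{J}'$, and their images in $\mathrm{Z}(\mathfrak{gl}_n,\mathfrak{gl}_{n-1})$, denoted by the same symbols, satisfy, for $i,j\in\{1,\dots,n-1\}$, $$z_{ni}z_{nj}=z_{nj}z_{ni}\quad\text{for all } i,j,\qquad z_{in}z_{nj}=z_{nj}z_{in}\quad\text{for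 } i\ne j,$$ and $$z_{in}z_{ni}=\prod_{j=1,\,j\ne i}^{n}(h_i-h_j-1)+\sum_{j=1}^{n-1}z_{nj}z_{jn}\prod_{k=1,\,k\ne j}^{n-1}\frac{h_i-h_k-1}{h_j-h_k}.$$ -/

import Mathlib

noncomputable section

open OreLocalization

attribute [local instance 100] LieRing.ofAssociativeRing

namespace MickelssonZhelobenko

/-! ### Normalizers of left ideals -/

section LeftNormalizer

variable {A : Type*} [Ring A]

/-- The normalizer `Norm J = {u | J u ⊆ J}` of a left ideal `J` of a ring `A`, as a subring of `A`.
(In Mathlib, `Ideal A` is the type of left ideals of `A`.) -/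
def leftNormalizer (J : Ideal A) : Subring A where
  carrier := {u | ∀ x ∈ J, x * u ∈ J}
  mul_mem' := by
    intro a b ha hb x hx
    rw [← mul_assoc]
    exact hb _ (ha x hx)
  one_mem' := by intro x hx; simpa using hx
  add_mem' := by
    intro a b ha hb x hx
    rw [mul_add]
    exact J.add_mem (ha x hx) (hb x hx)
  zero_mem' := by intro x _; simp
  neg_mem' := by
    intro a ha x hx
    rw [mul_neg]
    exact J.neg_mem (ha x hx)

theorem mem_leftNormalizer {J : Ideal A} {u : A} :
    u ∈ leftNormalizer J ↔ ∀ x ∈ J, x * u ∈ J := Iff.rfl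

/-- The left ideal `J`, regarded as a left ideal of its normalizer `Norm J` (which contains it). -/
def idealInNormalizer (J : Ideal A) : Ideal (leftNormalizer J) :=
  J.comap (leftNormalizer J).subtype

instance (J : Ideal A) : (idealInNormalizer J).IsTwoSided where
  mul_mem_of_left b ha := b.2 _ ha

end LeftNormalizer

/-! ### The universal enveloping algebra of `gl_{m+1}` -/

/-- The universal enveloping algebra `U(gl_{m+1})` over `ℂ`. The Lie algebra `gl_{m+1}` is the
space of `(m+1) × (m+1)` matrices, with the commutator as bracket. -/
abbrev Ugl (m : ℕ) : Type :=
  UniversalEnvelopingAlgebra ℂ (Matrix (Fin (m + 1)) (Fin (m + 1)) ℂ)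

variable {m : ℕ}

/-- The matrix unit `E_{ab}`, as an element of `U(gl_{m+1})`. -/
def E (a b : Fin (m + 1)) : Ugl m :=
  UniversalEnvelopingAlgebra.ι ℂ (Matrix.single a b (1 : ℂ))

theorem E_mul_E (a b c d : Fin (m + 1)) :
    (E a b : Ugl m) * E c d = E c d * E a b + (if b = c then E a d else 0)
      - (if d = a then E c b else 0) := by
  have h : (E a b : Ugl m) * E c d - E c d * E a b
      = UniversalEnvelopingAlgebra.ι ℂ
        ⁅Matrix.single a b (1 : ℂ), Matrix.single c d (1 : ℂ)⁆ := by
    rw [LieHom.map_lie]; rfl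
  have h2 : ⁅Matrix.single a b (1 : ℂ), Matrix.single c d (1 : ℂ)⁆
      = (if b = c then Matrix.single a d (1 : ℂ) else 0)
        - (if d = a then Matrix.single c b (1 : ℂ) else 0) := by
    rw [LieRing.of_associative_ring_bracket]
    congr 1
    · split_ifs with h
      · subst h; simp
      · exact Matrix.single_mul_single_of_ne _ _ _ _ h _
    · split_ifs with h
      · subst h; simp
      · exact Matrix.single_mul_single_of_ne _ _ _ _ h _
  rw [h2, map_sub] at h
  rw [sub_eq_iff_eq_add] at h
  rw [h]
  have e1 : (UniversalEnvelopingAlgebra.ι ℂ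
      (if b = c then Matrix.single a d (1 : ℂ) else 0) : Ugl m) = if b = c then E a d else 0 := by
    split_ifs
    · rfl
    · simp
  have e2 : (UniversalEnvelopingAlgebra.ι ℂ
      (if d = a then Matrix.single c b (1 : ℂ) else 0) : Ugl m) = if d = a then E c b else 0 := by
    split_ifs
    · rfl
    · simp
  rw [e1, e2]
  abel

theorem E_diag_comm (a b : Fin (m + 1)) : (E a a : Ugl m) * E b b = E b b * E a a := by
  rw [E_mul_E]
  by_cases h : a = b
  · subst h; simp
  · simp [h, Ne.symm h]

/-- A subalgebra of `U(gl_{m+1})` containing the matrix units is everything. -/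
theorem subalgebra_eq_top (B : Subalgebra ℂ (Ugl m)) (h : ∀ a b, E a b ∈ B) : B = ⊤ := by
  have hι : ∀ x, UniversalEnvelopingAlgebra.ι ℂ x ∈ B := by
    intro x
    have hx : UniversalEnvelopingAlgebra.ι ℂ x = ∑ a, ∑ b, x a b • (E a b : Ugl m) := by
      conv_lhs => rw [Matrix.matrix_eq_sum_single x]
      simp only [map_sum, E, ← map_smul]
      simp [Matrix.smul_single]
    rw [hx]
    exact sum_mem fun a _ => sum_mem fun b _ => B.smul_mem (h a b) _
  let f : Matrix (Fin (m + 1)) (Fin (m + 1)) ℂ →ₗ⁅ℂ⁆ B :=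
    { toFun := fun x => ⟨UniversalEnvelopingAlgebra.ι ℂ x, hι x⟩
      map_add' := fun x y => Subtype.ext (map_add _ x y)
      map_smul' := fun c x => Subtype.ext (map_smul _ c x)
      map_lie' := fun {x y} => Subtype.ext (LieHom.map_lie _ x y) }
  have hid : B.val.comp (UniversalEnvelopingAlgebra.lift ℂ f) = AlgHom.id ℂ (Ugl m) := by
    ext x
    simp [f]
  rw [eq_top_iff]
  intro u _
  have := congrArg (fun g : Ugl m →ₐ[ℂ] Ugl m => g u) hid
  simp only [AlgHom.comp_apply, AlgHom.id_apply] at this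
  rw [← this]
  exact Subtype.property _

/-! ### Cartan subalgebras -/

/-- The inclusion into `U(gl_{m+1})` of the enveloping algebra of the diagonal subalgebra, which
is the polynomial ring in the commuting variables `E_{11}, …, E_{m+1,m+1}`. -/
def cartan (m : ℕ) : MvPolynomial (Fin (m + 1)) ℂ →ₐ[ℂ] Ugl m :=
  letI B : Subalgebra ℂ (Ugl m) := Algebra.adjoin ℂ (Set.range fun a => E a a)
  haveI hB : IsMulCommutative B := Algebra.isMulCommutative_adjoin ℂ (by
    rintro _ ⟨a, rfl⟩ _ ⟨b, rfl⟩
    exact E_diag_comm a b)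
  letI : CommRing B := { (inferInstance : Ring B) with mul_comm := hB.is_comm.comm }
  B.val.comp (MvPolynomial.aeval (S₁ := B) fun a => ⟨E a a, Algebra.subset_adjoin ⟨a, rfl⟩⟩)

@[simp]
theorem cartan_X (a : Fin (m + 1)) : cartan m (MvPolynomial.X a) = E a a := by
  simp [cartan]

/-- The enveloping algebra `U(𝔥)` of the Cartan subalgebra `𝔥` of `gl_m` (the diagonal matrices):
the polynomial ring in the variables `E_{11}, …, E_{mm}`. -/
abbrev Uh (m : ℕ) : Type := MvPolynomial (Fin m) ℂ

/-- The field of fractions `R(𝔥)` of `U(𝔥)`. -/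
abbrev Rh (m : ℕ) : Type := FractionRing (Uh m)

/-- The inclusion of `U(𝔥)` into `U(gl_{m+1})`; here `gl_m` is the upper left corner. -/
def cartanSub (m : ℕ) : Uh m →ₐ[ℂ] Ugl m :=
  (cartan m).comp (MvPolynomial.rename Fin.castSucc)

@[simp]
theorem cartanSub_X (i : Fin m) :
    cartanSub m (MvPolynomial.X i) = E i.castSucc i.castSucc := by
  simp [cartanSub]

/-- The translation `x_i ↦ x_i - w_i` of a polynomial ring. -/
def shift {σ : Type} (w : σ → ℤ) : MvPolynomial σ ℂ →ₐ[ℂ] MvPolynomial σ ℂ :=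
  MvPolynomial.aeval fun i => MvPolynomial.X i - MvPolynomial.C (w i : ℂ)

theorem shift_injective {σ : Type} (w : σ → ℤ) : Function.Injective (shift w) := by
  have h : (shift (-w)).comp (shift w) = AlgHom.id ℂ (MvPolynomial σ ℂ) := by
    ext i
    simp [shift]
  intro p q hpq
  have := congrArg (shift (-w)) hpq
  rwa [← AlgHom.comp_apply, ← AlgHom.comp_apply, h] at this

/-- The weight of `E_{ab}` for the diagonal subalgebra of `gl_{m+1}`. -/
def weight (a b : Fin (m + 1)) : Fin (m + 1) → ℤ := Pi.single a 1 - Pi.single b 1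

theorem E_mul_cartan (a b : Fin (m + 1)) (f : MvPolynomial (Fin (m + 1)) ℂ) :
    E a b * cartan m f = cartan m (shift (weight a b) f) * E a b := by
  induction f using MvPolynomial.induction_on with
  | C c =>
    rw [← MvPolynomial.algebraMap_eq, AlgHom.commutes, AlgHom.commutes, AlgHom.commutes]
    exact (Algebra.commutes c _).symm
  | add p q hp hq => simp only [map_add, mul_add, add_mul, hp, hq]
  | mul_X p i hp =>
    have key : (E a b : Ugl m) * E i i
        = cartan m (shift (weight a b) (MvPolynomial.X i)) * E a b := by
      have hC : ∀ c : ℂ, cartan m (MvPolynomial.C c) = algebraMap ℂ _ c := fun c => by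
        rw [← MvPolynomial.algebraMap_eq, AlgHom.commutes]
      rw [E_mul_E, shift, MvPolynomial.aeval_X, map_sub, cartan_X, hC, sub_mul,
        weight, Pi.sub_apply, Pi.single_apply, Pi.single_apply]
      by_cases h1 : b = i <;> by_cases h2 : i = a
      · subst h1; subst h2; simp
      · subst h1; simp [h2]
      · subst h2; simp [h1, Ne.symm h1]
      · simp [h1, h2, Ne.symm h1]
    rw [map_mul, map_mul, map_mul, cartan_X, ← mul_assoc, hp, mul_assoc, key, ← mul_assoc]

theorem shift_rename (w : Fin (m + 1) → ℤ) (f : Uh m) :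
    shift w (MvPolynomial.rename Fin.castSucc f)
      = MvPolynomial.rename Fin.castSucc (shift (fun i => w i.castSucc) f) := by
  have h : (shift w).comp (MvPolynomial.rename Fin.castSucc)
      = (MvPolynomial.rename Fin.castSucc).comp (shift (fun i : Fin m => w i.castSucc)) := by
    ext i
    simp [shift]
  exact congrArg (fun g : Uh m →ₐ[ℂ] _ => g f) h

/-- The weight of `E_{ab}` for the diagonal subalgebra of `gl_m`. -/
def weightSub (a b : Fin (m + 1)) : Fin m → ℤ := fun i => weight a b i.castSucc

theorem E_mul_cartanSub (a b : Fin (m + 1)) (f : Uh m) :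
    E a b * cartanSub m f = cartanSub m (shift (weightSub a b) f) * E a b := by
  simp only [cartanSub, AlgHom.comp_apply]
  rw [E_mul_cartan, shift_rename]
  rfl

/-! ### The denominators form an Ore set -/

/-- The nonzero elements of `U(𝔥)`, as a multiplicative subset of `U(gl_{m+1})`. -/
def denominators (m : ℕ) : Submonoid (Ugl m) :=
  (nonZeroDivisors (Uh m)).map (cartanSub m)

theorem exists_ore (r : Ugl m) (s : denominators m) :
    ∃ (r' : Ugl m) (s' : denominators m), (s' : Ugl m) * r = r' * s := by
  let B : Subalgebra ℂ (Ugl m) :=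
    { carrier := {r | ∀ s : denominators m,
        ∃ (r' : Ugl m) (s' : denominators m), (s' : Ugl m) * r = r' * s}
      mul_mem' := by
        intro a b ha hb s
        obtain ⟨b', s', h1⟩ := hb s
        obtain ⟨a', s'', h2⟩ := ha s'
        exact ⟨a' * b', s'', by rw [← mul_assoc, h2, mul_assoc, h1, mul_assoc]⟩
      add_mem' := by
        intro a b ha hb s
        obtain ⟨a', s₁, h1⟩ := ha s
        obtain ⟨b', s₂, h2⟩ := hb s
        have hc : (s₁ : Ugl m) * s₂ = s₂ * s₁ := by
          obtain ⟨_, f, _, rfl⟩ := s₁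
          obtain ⟨_, g, _, rfl⟩ := s₂
          change cartanSub m f * cartanSub m g = cartanSub m g * cartanSub m f
          rw [← map_mul, mul_comm, map_mul]
        refine ⟨s₂ * a' + s₁ * b', s₁ * s₂, ?_⟩
        have e1 : (s₁ : Ugl m) * s₂ * a = s₂ * a' * s := by rw [hc, mul_assoc, h1, mul_assoc]
        have e2 : (s₁ : Ugl m) * s₂ * b = s₁ * b' * s := by rw [mul_assoc, h2, mul_assoc]
        rw [Submonoid.coe_mul, mul_add, add_mul, e1, e2]
      algebraMap_mem' := fun c s => ⟨algebraMap ℂ _ c, s, (Algebra.commutes c _).symm⟩ }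
  have hB : B = ⊤ := by
    refine subalgebra_eq_top B fun a b s => ?_
    obtain ⟨_, f, hf, rfl⟩ := s
    refine ⟨E a b, ⟨cartanSub m (shift (weightSub a b) f), _, ?_, rfl⟩,
      (E_mul_cartanSub a b f).symm⟩
    rw [SetLike.mem_coe, mem_nonZeroDivisors_iff_ne_zero] at hf ⊢
    exact fun h => hf (shift_injective _ (by rw [h, map_zero]))
  have : r ∈ B := by rw [hB]; trivial
  exact this s

/-- The linear map underlying the grading of `U(gl_{m+1})` by the weights of `𝔥`. -/
def gradingLin (m : ℕ) : Matrix (Fin (m + 1)) (Fin (m + 1)) ℂ →ₗ[ℂ]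
    AddMonoidAlgebra (Ugl m) (Fin m → ℤ) where
  toFun x := ∑ a, ∑ b, AddMonoidAlgebra.single (weightSub a b) (x a b • E a b)
  map_add' x y := by
    simp only [Matrix.add_apply, add_smul, AddMonoidAlgebra.single_add, Finset.sum_add_distrib]
  map_smul' c x := by
    simp only [Matrix.smul_apply, smul_eq_mul, mul_smul, Finset.smul_sum, RingHom.id_apply,
      AddMonoidAlgebra.smul_single]

theorem gradingLin_single (a b : Fin (m + 1)) (c : ℂ) :
    gradingLin m (Matrix.single a b c) = AddMonoidAlgebra.single (weightSub a b) (c • E a b) := by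
  change ∑ a', ∑ b', AddMonoidAlgebra.single (weightSub a' b')
    (Matrix.single a b c a' b' • (E a' b' : Ugl m)) = _
  rw [Finset.sum_eq_single a, Finset.sum_eq_single b]
  · simp
  · intro b' _ hb
    simp [Ne.symm hb]
  · simp
  · intro a' _ ha
    simp [Ne.symm ha]
  · simp

theorem gradingLin_lie (x y : Matrix (Fin (m + 1)) (Fin (m + 1)) ℂ) :
    gradingLin m ⁅x, y⁆ = ⁅gradingLin m x, gradingLin m y⁆ := by
  induction x using Matrix.induction_on' with
  | h_zero => simp
  | h_add p q hp hq => rw [add_lie, map_add, map_add, add_lie, hp, hq]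
  | h_std_basis a b s =>
    induction y using Matrix.induction_on' with
    | h_zero => simp
    | h_add p q hp hq => rw [lie_add, map_add, map_add, lie_add, hp, hq]
    | h_std_basis c d t =>
      have hw : ∀ p q r : Fin (m + 1), (weightSub p q : Fin m → ℤ) + weightSub q r
          = weightSub p r := by
        intro p q r
        funext i
        simp [weightSub, weight]
      have h1 : ⁅Matrix.single a b s, Matrix.single c d t⁆
          = (if b = c then Matrix.single a d (s * t) else 0)
            - (if d = a then Matrix.single c b (t * s) else 0) := by
        rw [LieRing.of_associative_ring_bracket]
        congr 1
        · split_ifs with h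
          · subst h; simp
          · exact Matrix.single_mul_single_of_ne _ _ _ _ h _
        · split_ifs with h
          · subst h; simp
          · exact Matrix.single_mul_single_of_ne _ _ _ _ h _
      have h2 : (E a b : Ugl m) * E c d - E c d * E a b
          = (if b = c then E a d else 0) - (if d = a then E c b else 0) := by
        rw [E_mul_E]; abel
      rw [h1, map_sub, LieRing.of_associative_ring_bracket, gradingLin_single, gradingLin_single,
        AddMonoidAlgebra.single_mul_single, AddMonoidAlgebra.single_mul_single,
        add_comm (weightSub c d), ← AddMonoidAlgebra.single_sub]
      have h3 : (s • (E a b : Ugl m)) * t • E c d - t • E c d * s • E a b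
          = (s * t) • ((if b = c then E a d else 0) - (if d = a then E c b else 0)) := by
        rw [← h2, smul_mul_smul_comm, smul_mul_smul_comm, mul_comm t s, smul_sub]
      rw [h3, mul_comm t s, smul_sub, AddMonoidAlgebra.single_sub]
      congr 1
      · split_ifs with h
        · subst h; rw [gradingLin_single, hw]
        · simp
      · split_ifs with h
        · subst h; rw [gradingLin_single, add_comm (weightSub _ _), hw]
        · simp

/-- The grading of `U(gl_{m+1})` by the weights of `𝔥`, as a coaction: an element is sent to the
formal sum of its weight components. -/
def grading (m : ℕ) : Ugl m →ₐ[ℂ] AddMonoidAlgebra (Ugl m) (Fin m → ℤ) :=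
  UniversalEnvelopingAlgebra.lift ℂ
    { gradingLin m with map_lie' := fun {x y} => gradingLin_lie x y }

theorem grading_E (a b : Fin (m + 1)) :
    grading m (E a b) = AddMonoidAlgebra.single (weightSub a b) (E a b) := by
  have h : grading m (E a b) = gradingLin m (Matrix.single a b 1) := by
    rw [grading, E, UniversalEnvelopingAlgebra.lift_ι_apply]
    rfl
  rw [h, gradingLin_single, one_smul]

theorem grading_cartanSub (f : Uh m) :
    grading m (cartanSub m f) = AddMonoidAlgebra.single 0 (cartanSub m f) := by
  induction f using MvPolynomial.induction_on with
  | C c =>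
    rw [← MvPolynomial.algebraMap_eq, AlgHom.commutes, AlgHom.commutes]
    rfl
  | add p q hp hq => rw [map_add, map_add, hp, hq, AddMonoidAlgebra.single_add]
  | mul_X p i hp =>
    rw [map_mul, map_mul, hp, cartanSub_X, grading_E, AddMonoidAlgebra.single_mul_single]
    congr 1
    funext j
    simp [weightSub, weight]

theorem sum_grading (r : Ugl m) : (grading m r).coeff.sum (fun _ u => u) = r := by
  let F : AddMonoidAlgebra (Ugl m) (Fin m → ℤ) →ₐ[ℂ] Ugl m :=
    AddMonoidAlgebra.liftNCAlgHom (AlgHom.id ℂ _) 1 (fun _ _ => Commute.one_right _)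
  have hs : ∀ w u, F (AddMonoidAlgebra.single w u) = u := by
    intro w u
    simp [F]
  have hF : ∀ x, F x = x.coeff.sum (fun _ u => u) := by
    intro x
    conv_lhs => rw [← AddMonoidAlgebra.sum_coeff_single x]
    rw [Finsupp.sum, map_sum, Finsupp.sum]
    exact Finset.sum_congr rfl fun w _ => hs w _
  have hB : AlgHom.equalizer (F.comp (grading m)) (AlgHom.id ℂ _) = ⊤ := by
    refine subalgebra_eq_top _ fun a b => ?_
    change F (grading m (E a b)) = E a b
    rw [grading_E, hs]
  have hr : r ∈ AlgHom.equalizer (F.comp (grading m)) (AlgHom.id ℂ _) := by rw [hB]; trivial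
  rw [← hF]
  exact hr

theorem shift_add {σ : Type} (v w : σ → ℤ) (f : MvPolynomial σ ℂ) :
    shift v (shift w f) = shift (v + w) f := by
  have h : (shift v).comp (shift w) = shift (v + w) := by
    ext i
    simp [shift, sub_sub]
  exact congrArg (fun g : MvPolynomial σ ℂ →ₐ[ℂ] _ => g f) h

theorem grading_mul_cartanSub (r : Ugl m) (w : Fin m → ℤ) (f : Uh m) :
    (grading m r).coeff w * cartanSub m f
      = cartanSub m (shift w f) * (grading m r).coeff w := by
  classical
  let B : Subalgebra ℂ (Ugl m) :=
    { carrier := {r | ∀ (w : Fin m → ℤ) (f : Uh m), (grading m r).coeff w * cartanSub m f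
        = cartanSub m (shift w f) * (grading m r).coeff w}
      mul_mem' := by
        intro a b ha hb w f
        rw [map_mul, AddMonoidAlgebra.coeff_mul]
        simp only [Finsupp.sum, Finset.sum_mul, Finset.mul_sum]
        refine Finset.sum_congr rfl fun v₁ _ => Finset.sum_congr rfl fun v₂ _ => ?_
        split_ifs with h
        · rw [mul_assoc, hb, ← mul_assoc, ha, shift_add, h, mul_assoc]
        · simp
      add_mem' := by
        intro a b ha hb w f
        rw [map_add, AddMonoidAlgebra.coeff_add, Finsupp.add_apply, add_mul, mul_add, ha, hb]
      algebraMap_mem' := fun c w f => by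
        have h : grading m (algebraMap ℂ _ c) = AddMonoidAlgebra.single 0 (algebraMap ℂ _ c) := by
          rw [AlgHom.commutes]; rfl
        rw [h, AddMonoidAlgebra.coeff_single, Finsupp.single_apply]
        split_ifs with hw
        · have h0 : shift w f = f := by
            have : shift w = AlgHom.id ℂ (Uh m) := by
              ext i
              simp [shift, ← hw]
            rw [this]; rfl
          rw [h0]
          exact Algebra.commutes c _
        · simp }
  have hB : B = ⊤ := by
    refine subalgebra_eq_top B fun a b w f => ?_
    rw [grading_E, AddMonoidAlgebra.coeff_single, Finsupp.single_apply]
    split_ifs with hw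
    · rw [← hw, E_mul_cartanSub]
    · simp
  have : r ∈ B := by rw [hB]; trivial
  exact this w f

theorem exists_mul_eq_zero (r : Ugl m) (s : denominators m) (h : r * s = 0) :
    ∃ s' : denominators m, (s' : Ugl m) * r = 0 := by
  classical
  obtain ⟨_, f, hf, rfl⟩ := s
  rw [SetLike.mem_coe, mem_nonZeroDivisors_iff_ne_zero] at hf
  change r * cartanSub m f = 0 at h
  have hw : ∀ w, cartanSub m (shift w f) * (grading m r).coeff w = 0 := by
    intro w
    rw [← grading_mul_cartanSub]
    have h2 := congrArg (fun x => (grading m x).coeff w) h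
    simpa [grading_cartanSub, AddMonoidAlgebra.coeff_mul_single_zero] using h2
  refine ⟨⟨cartanSub m (∏ w ∈ (grading m r).coeff.support, shift w f), _, ?_, rfl⟩, ?_⟩
  · rw [SetLike.mem_coe, mem_nonZeroDivisors_iff_ne_zero, Finset.prod_ne_zero_iff]
    exact fun w _ h => hf (shift_injective w (by rw [h, map_zero]))
  · change cartanSub m (∏ w ∈ (grading m r).coeff.support, shift w f) * r = 0
    rw [show ∀ u : Ugl m, u * r = u * (grading m r).coeff.sum (fun _ u => u) from
      fun u => by rw [sum_grading], Finsupp.sum, Finset.mul_sum]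
    refine Finset.sum_eq_zero fun w hws => ?_
    rw [← Finset.prod_erase_mul _ _ hws, map_mul, mul_assoc, hw, mul_zero]

instance oreSetDenominators (m : ℕ) : OreSet (denominators m) :=
  Classical.choice (nonempty_oreSet_iff.mpr
    ⟨fun r₁ r₂ s h => by
      obtain ⟨s', hs'⟩ := exists_mul_eq_zero (r₁ - r₂) s (by rw [sub_mul, h, sub_self])
      exact ⟨s', by rwa [mul_sub, sub_eq_zero] at hs'⟩,
    exists_ore⟩)

/-! ### The extension `U'(gl_{m+1})` and the algebra `Z(gl_{m+1}, gl_m)` -/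

/-- The extension `U'(gl_{m+1}) = U(gl_{m+1}) ⊗_{U(𝔥)} R(𝔥)` of the enveloping algebra. As an
algebra, it is the ring of fractions of `U(gl_{m+1})` with respect to the (two-sided) Ore set of
nonzero elements of `U(𝔥)`. -/
abbrev UglExt (m : ℕ) : Type := OreLocalization (denominators m) (Ugl m)

/-- The canonical homomorphism `U(gl_{m+1}) → U'(gl_{m+1})`. -/
abbrev toExt (m : ℕ) : Ugl m →+* UglExt m := numeratorRingHom

/-- A nonzero element of `U(𝔥)`, as an invertible element of `U'(gl_{m+1})`. -/
def unitExt (m : ℕ) : nonZeroDivisors (Uh m) →* (UglExt m)ˣ where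
  toFun g := numeratorUnit ⟨cartanSub m g, g, g.2, rfl⟩
  map_one' := Units.ext (by
    change toExt m (cartanSub m 1) = 1
    rw [map_one, map_one])
  map_mul' f g := Units.ext (by
    change toExt m (cartanSub m (f * g)) = toExt m (cartanSub m f) * toExt m (cartanSub m g)
    rw [map_mul, map_mul])

/-- The inclusion of the field `R(𝔥)` into `U'(gl_{m+1})`, sending a fraction `f / g` to
`g⁻¹ f`. -/
def fracExt (m : ℕ) : Rh m →+* UglExt m :=
  OreLocalization.universalHom ((toExt m).comp (cartanSub m).toRingHom) (unitExt m)
    (fun _ => rfl)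

theorem fracExt_oreDiv (f : Uh m) (g : nonZeroDivisors (Uh m)) :
    fracExt m (f /ₒ g) = ((unitExt m g)⁻¹ : (UglExt m)ˣ) * toExt m (cartanSub m f) := rfl

/-- The left ideal `J' = U'(gl_{m+1}) 𝔨⁺` generated by the positive root vectors `E_{ij}`,
`1 ≤ i < j ≤ m`, of `𝔨 = gl_m`. -/
def idealJ (m : ℕ) : Ideal (UglExt m) :=
  Ideal.span {x | ∃ i j : Fin m, i < j ∧ x = toExt m (E i.castSucc j.castSucc)}

/-- The Mickelsson–Zhelobenko algebra `Z(gl_{m+1}, gl_m) = Norm J' / J'`. -/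
abbrev MZ (m : ℕ) : Type :=
  leftNormalizer (idealJ m) ⧸ idealInNormalizer (idealJ m)

/-- The class in `Z(gl_{m+1}, gl_m)` of an element of the normalizer. -/
def MZ.mk {m : ℕ} (u : UglExt m) (hu : u ∈ leftNormalizer (idealJ m)) : MZ m :=
  Ideal.Quotient.mk (idealInNormalizer (idealJ m)) ⟨u, hu⟩

theorem mem_leftNormalizer_of_root {u : UglExt m}
    (h : ∀ i j : Fin m, i < j → ∃ v, toExt m (E i.castSucc j.castSucc) * u
      = v * toExt m (E i.castSucc j.castSucc)) : u ∈ leftNormalizer (idealJ m) := by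
  intro x hx
  refine Submodule.span_induction ?_ ?_ ?_ ?_ hx
  · rintro _ ⟨i, j, hij, rfl⟩
    obtain ⟨v, hv⟩ := h i j hij
    rw [hv]
    exact Ideal.mul_mem_left _ _ (Submodule.subset_span ⟨i, j, hij, rfl⟩)
  · rw [zero_mul]; exact Submodule.zero_mem _
  · intro a b _ _ ha hb
    rw [add_mul]; exact Submodule.add_mem _ ha hb
  · intro c a _ ha
    rw [smul_eq_mul, mul_assoc]
    exact Ideal.mul_mem_left _ _ ha

theorem cartan_mem_leftNormalizer (f : MvPolynomial (Fin (m + 1)) ℂ) :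
    toExt m (cartan m f) ∈ leftNormalizer (idealJ m) := by
  refine mem_leftNormalizer_of_root fun i j _ => ?_
  rw [← map_mul, E_mul_cartan, map_mul]
  exact ⟨_, rfl⟩

theorem fracExt_mem_leftNormalizer (q : Rh m) :
    fracExt m q ∈ leftNormalizer (idealJ m) := by
  refine mem_leftNormalizer_of_root fun i j _ => ?_
  induction q using OreLocalization.ind with
  | c f g =>
    rw [fracExt_oreDiv]
    have hg : shift (weightSub i.castSucc j.castSucc) (g : Uh m) ∈ nonZeroDivisors (Uh m) := by
      rw [mem_nonZeroDivisors_iff_ne_zero]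
      intro h
      exact nonZeroDivisors.coe_ne_zero g (shift_injective _ (by rw [h, map_zero]))
    refine ⟨((unitExt m ⟨_, hg⟩)⁻¹ : (UglExt m)ˣ)
      * toExt m (cartanSub m (shift (weightSub i.castSucc j.castSucc) f)), ?_⟩
    have h1 : toExt m (E i.castSucc j.castSucc) * (unitExt m g : UglExt m)
        = unitExt m ⟨_, hg⟩ * toExt m (E i.castSucc j.castSucc) := by
      change toExt m (E i.castSucc j.castSucc) * toExt m (cartanSub m g)
        = toExt m (cartanSub m (shift (weightSub i.castSucc j.castSucc) g)) * _
      rw [← map_mul, E_mul_cartanSub, map_mul]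
    have h2 : toExt m (E i.castSucc j.castSucc) * ((unitExt m g)⁻¹ : (UglExt m)ˣ)
        = ((unitExt m ⟨_, hg⟩)⁻¹ : (UglExt m)ˣ) * toExt m (E i.castSucc j.castSucc) := by
      rw [Units.eq_inv_mul_iff_mul_eq, ← mul_assoc, ← h1, mul_assoc, Units.mul_inv, mul_one]
    rw [← mul_assoc, h2, mul_assoc, mul_assoc, ← map_mul, E_mul_cartanSub, map_mul]

/-- The polynomials in `E_{11}, …, E_{m+1,m+1}`, as elements of `Z(gl_{m+1}, gl_m)`. -/
def MZ.cartan (m : ℕ) : MvPolynomial (Fin (m + 1)) ℂ →+* MZ m :=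
  (Ideal.Quotient.mk (idealInNormalizer (idealJ m))).comp
    (((toExt m).comp (MickelssonZhelobenko.cartan m).toRingHom).codRestrict
      (leftNormalizer (idealJ m)) cartan_mem_leftNormalizer)

/-- The rational functions in `E_{11}, …, E_{mm}`, as elements of `Z(gl_{m+1}, gl_m)`. -/
def MZ.frac (m : ℕ) : Rh m →+* MZ m :=
  (Ideal.Quotient.mk (idealInNormalizer (idealJ m))).comp
    ((fracExt m).codRestrict (leftNormalizer (idealJ m)) fracExt_mem_leftNormalizer)

/-! ### Raising and lowering operators -/

/-- The polynomial `h_a = E_{aa} - a + 1`, for `a = 1, …, m + 1`. (The index `a : Fin (m + 1)`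
starts at `0`, so the shift `-a + 1` becomes `-a`.) -/
def h (a : Fin (m + 1)) : MvPolynomial (Fin (m + 1)) ℂ :=
  MvPolynomial.X a - MvPolynomial.C ((a : ℕ) : ℂ)

/-- The element `h_i = E_{ii} - i + 1` of `R(𝔥)`, for `i = 1, …, m` (indexed from `0`). -/
def hFrac (i : Fin m) : Rh m :=
  algebraMap (Uh m) (Rh m) (MvPolynomial.X i - MvPolynomial.C ((i : ℕ) : ℂ))

/-- `raisingWord i [i₁, …, i_s] = E_{i i₁} E_{i₁ i₂} ⋯ E_{i_s n}`, where `n = m + 1`. -/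
def raisingWord : Fin m → List (Fin m) → Ugl m
  | i, [] => E i.castSucc (Fin.last m)
  | i, k :: l => E i.castSucc k.castSucc * raisingWord k l

/-- `loweringWord i [i₁, …, i_s] = E_{i₁ i} E_{i₂ i₁} ⋯ E_{n i_s}`, where `n = m + 1`. -/
def loweringWord : Fin m → List (Fin m) → Ugl m
  | i, [] => E (Fin.last m) i.castSucc
  | i, k :: l => E k.castSucc i.castSucc * loweringWord k l

/-- The raising operator `z_{in} ∈ U(gl_n)`, where `n = m + 1`:
`z_{in} = ∑_{i > i₁ > ⋯ > i_s ≥ 1} E_{i i₁} E_{i₁ i₂} ⋯ E_{i_s n} (h_i - h_{j₁}) ⋯ (h_i - h_{j_r})`,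
where `{j₁, …, j_r}` is the complement of `{i₁, …, i_s}` in `{1, …, i - 1}`. -/
def raising (i : Fin m) : Ugl m :=
  ∑ I ∈ (Finset.Iio i).powerset, raisingWord i (I.sort (· ≥ ·)) *
    cartan m (∏ j ∈ Finset.Iio i \ I, (h i.castSucc - h j.castSucc))

/-- The lowering operator `z_{ni} ∈ U(gl_n)`, where `n = m + 1`:
`z_{ni} = ∑_{i < i₁ < ⋯ < i_s < n} E_{i₁ i} E_{i₂ i₁} ⋯ E_{n i_s} (h_i - h_{j₁}) ⋯ (h_i - h_{j_r})`,
where `{j₁, …, j_r}` is the complement of `{i₁, …, i_s}` in `{i + 1, …, n - 1}`. -/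
def lowering (i : Fin m) : Ugl m :=
  ∑ I ∈ (Finset.Ioi i).powerset, loweringWord i (I.sort (· ≤ ·)) *
    cartan m (∏ j ∈ Finset.Ioi i \ I, (h i.castSucc - h j.castSucc))

end MickelssonZhelobenko

end

namespace MickelssonZhelobenko

variable {m : ℕ}

/-! ### The left ideal generated by the positive roots, pulled back to `U(gl_{m+1})` -/

/-! With `n = m + 1`, call `u` singular if every positive root vector of `gl_m` sends it into `J'`.
Since `J'` is a left ideal generated by these vectors, a singular element lies in `Norm J'`. The
raising and lowering operators are singular by a direct induction with the simple roots
(`E_succ_mul_lowerAt`, `E_succ_mul_raiseAt`). Each relation then asserts that a certain singular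
weight element, the difference of its two sides, is zero modulo `J'`; in the last relation the
denominators are cleared first.

The vanishing criterion is `IsSingular.mem_rootIdeal`. The Casimir element `C` of `gl_m` commutes
with `gl_m` and acts on a singular element of weight `ν` as right multiplication by a polynomial
`c_ν` in `U(𝔥)`, and `c_ν ≠ c_ν'` whenever the heights of `ν` and `ν'` differ. Elements of weight of
height greater than `k`, and whatever `gl_m` generates from them, are killed modulo `J'` by products
of operators `u ↦ C u - u c_ν'` with `height ν' > k` (`weightSpace_le_higher`, `E_mul_mem_higher`);
these form the subgroup `higher m k`. On a singular element `v` of weight `ν` with `height ν = k`,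
such a product acts as right multiplication by a product of the nonzero polynomials `c_ν - c_ν'`,
which is invertible in `R(𝔥)`. So if `v` lies in `higher m k`, then `v ∈ J'`.

Hence both sides need only be compared modulo `higher`. There every summand `E_{ki} u` whose `u` has
larger height disappears, and products of `z`'s reduce to products `E_{ni} E_{nj}`, or `E_{kn}
E_{nk}`, times polynomials in the `h`'s. The two commutation relations become short polynomial
identities. In the third, `z_{in} z_{ni}` and each `z_{nj} z_{jn}` expand over `k` with explicit
coefficients. Lagrange interpolation at the nodes `h_j`, evaluated at `h_i - 1`, matches the
coefficients (`coeff_identity`), and the commutators `[E_{kn}, E_{nk}]` sum telescopically to the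
constant term (`const_identity`). -/

/-- The contraction to `U(gl_{m+1})` of the left ideal `J'`. -/
noncomputable def rootIdeal (m : ℕ) : Ideal (Ugl m) := (idealJ m).comap (toExt m)

theorem mem_rootIdeal {x : Ugl m} : x ∈ rootIdeal m ↔ toExt m x ∈ idealJ m := Iff.rfl

theorem E_mem_rootIdeal {i j : Fin m} (hij : i < j) :
    E i.castSucc j.castSucc ∈ rootIdeal m :=
  Submodule.subset_span ⟨i, j, hij, rfl⟩

theorem rootIdeal_mul_cartan {x : Ugl m} (hx : x ∈ rootIdeal m)
    (f : MvPolynomial (Fin (m + 1)) ℂ) : x * cartan m f ∈ rootIdeal m := by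
  rw [mem_rootIdeal, map_mul]
  exact cartan_mem_leftNormalizer f _ hx

theorem fracExt_algebraMap (f : Uh m) :
    fracExt m (algebraMap (Uh m) (Rh m) f) = toExt m (cartanSub m f) :=
  OreLocalization.universalHom_commutes ((toExt m).comp (cartanSub m).toRingHom) (unitExt m)
    (fun _ => rfl)

/-- Right multiplication by `g⁻¹` preserves `J'`, because `R(𝔥)` lies in the normalizer. Nonzero
elements of `U(𝔥)` can therefore be cancelled on the right. -/
theorem mem_rootIdeal_of_mul_cartanSub {x : Ugl m} {g : Uh m} (hg : g ≠ 0)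
    (hx : x * cartanSub m g ∈ rootIdeal m) : x ∈ rootIdeal m := by
  rw [mem_rootIdeal, map_mul] at hx
  have h1 := fracExt_mem_leftNormalizer (algebraMap (Uh m) (Rh m) g)⁻¹ _ hx
  rw [← fracExt_algebraMap, mul_assoc, ← map_mul, mul_inv_cancel₀, map_one, mul_one] at h1
  · exact h1
  · rwa [Ne, FaithfulSMul.algebraMap_eq_zero_iff]

theorem mem_leftNormalizer_of_mul_mem {u : Ugl m}
    (h : ∀ i j : Fin m, i < j → E i.castSucc j.castSucc * u ∈ rootIdeal m) :
    toExt m u ∈ leftNormalizer (idealJ m) := by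
  intro x hx
  refine Submodule.span_induction ?_ ?_ ?_ ?_ hx
  · rintro _ ⟨i, j, hij, rfl⟩
    rw [← map_mul]
    exact h i j hij
  · rw [zero_mul]; exact Submodule.zero_mem _
  · intro a b _ _ ha hb
    rw [add_mul]; exact Submodule.add_mem _ ha hb
  · intro c a _ ha
    rw [smul_eq_mul, mul_assoc]
    exact Ideal.mul_mem_left _ _ ha

/-! ### Singular elements -/

/-- An element of `U(gl_{m+1})` annihilated modulo `J'` by the positive roots of `gl_m`. -/
def IsSingular (u : Ugl m) : Prop :=
  ∀ i j : Fin m, i < j → E i.castSucc j.castSucc * u ∈ rootIdeal m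

/-- A root vector moves `u` into `J'`, and `v`, being singular, normalizes `J'`. -/
theorem IsSingular.mul {u v : Ugl m} (hu : IsSingular u) (hv : IsSingular v) :
    IsSingular (u * v) := by
  intro i j hij
  rw [← mul_assoc, mem_rootIdeal, map_mul]
  exact mem_leftNormalizer_of_mul_mem hv _ (hu i j hij)

theorem IsSingular.sub {u v : Ugl m} (hu : IsSingular u) (hv : IsSingular v) :
    IsSingular (u - v) := by
  intro i j hij
  rw [mul_sub]
  exact sub_mem (hu i j hij) (hv i j hij)

theorem IsSingular.sum {ι : Type*} {s : Finset ι} {u : ι → Ugl m}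
    (hu : ∀ k ∈ s, IsSingular (u k)) : IsSingular (∑ k ∈ s, u k) := by
  intro i j hij
  rw [Finset.mul_sum]
  exact sum_mem fun k hk => hu k hk i j hij

theorem isSingular_cartan (f : MvPolynomial (Fin (m + 1)) ℂ) : IsSingular (cartan m f) := by
  intro i j hij
  exact rootIdeal_mul_cartan (E_mem_rootIdeal hij) f

theorem E_succ_mul_bracket {a b c : Fin (m + 1)} (h : c ≠ a) (u : Ugl m) :
    E a c * u = E a b * (E b c * u) - E b c * (E a b * u) := by
  rw [← mul_assoc, ← mul_assoc, E_mul_E]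
  simp [h, add_mul]

/-- The simple roots suffice to test singularity. -/
theorem isSingular_of_succ {u : Ugl m}
    (h : ∀ a b : Fin m, (b : ℕ) = a + 1 → E a.castSucc b.castSucc * u ∈ rootIdeal m) :
    IsSingular u := by
  have key : ∀ d : ℕ, ∀ i j : Fin m, (j : ℕ) = i + d + 1 →
      E i.castSucc j.castSucc * u ∈ rootIdeal m := by
    intro d
    induction d with
    | zero => intro i j hij; exact h i j (by omega)
    | succ d ih =>
      intro i j hij
      have hj := j.2
      let k : Fin m := ⟨i + d + 1, by omega⟩
      -- With `k = j - 1`, the root vector `E_{ij}` is the bracket of `E_{ik}` and the simple root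
      -- vector `E_{kj}`.
      rw [E_succ_mul_bracket (b := k.castSucc) (by rw [Ne, Fin.ext_iff]; simp; omega)]
      exact sub_mem (Ideal.mul_mem_left _ _ (h k j (by simp [k]; omega)))
        (Ideal.mul_mem_left _ _ (ih i k rfl))
  intro i j hij
  exact key (j - i - 1) i j (by have := Fin.lt_def.mp hij; omega)

/-! ### Weights -/

/-- The element `E_{a₁b₁} ⋯ E_{a_sb_s}` of `U(gl_{m+1})`. -/
noncomputable def word (l : List (Fin (m + 1) × Fin (m + 1))) : Ugl m :=
  (l.map fun p => E p.1 p.2).prod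

/-- The weight of `word l`. -/
def wordWeight (l : List (Fin (m + 1) × Fin (m + 1))) : Fin (m + 1) → ℤ :=
  (l.map fun p => weight p.1 p.2).sum

theorem shift_shift {σ : Type} (w w' : σ → ℤ) (f : MvPolynomial σ ℂ) :
    shift w (shift w' f) = shift (w + w') f := by
  have h : (shift w).comp (shift w') = shift (σ := σ) (w + w') := by
    ext i
    simp [shift, sub_sub]
  exact congrArg (fun g : MvPolynomial σ ℂ →ₐ[ℂ] _ => g f) h

theorem shift_zero {σ : Type} (f : MvPolynomial σ ℂ) : shift 0 f = f := by
  have h : shift 0 = AlgHom.id ℂ (MvPolynomial σ ℂ) := by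
    ext i
    simp [shift]
  rw [h, AlgHom.id_apply]

theorem word_mul_cartan (l : List (Fin (m + 1) × Fin (m + 1)))
    (f : MvPolynomial (Fin (m + 1)) ℂ) :
    word l * cartan m f = cartan m (shift (wordWeight l) f) * word l := by
  induction l with
  | nil => simp [word, wordWeight, shift_zero]
  | cons p l ih =>
    simp only [word, wordWeight, List.map_cons, List.prod_cons, List.sum_cons] at ih ⊢
    rw [mul_assoc, ih, ← mul_assoc, E_mul_cartan, shift_shift, mul_assoc]

/-- The subgroup of elements of weight `ν` in `U(gl_{m+1})`. -/
def weightSpace (ν : Fin (m + 1) → ℤ) : AddSubgroup (Ugl m) :=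
  AddSubgroup.closure {u | ∃ l f, wordWeight l = ν ∧ u = word l * cartan m f}

theorem cartan_mul_of_mem {ν : Fin (m + 1) → ℤ} {u : Ugl m} (hu : u ∈ weightSpace ν)
    (f : MvPolynomial (Fin (m + 1)) ℂ) :
    cartan m f * u = u * cartan m (shift (-ν) f) := by
  induction hu using AddSubgroup.closure_induction with
  | mem u hu =>
    obtain ⟨l, g, rfl, rfl⟩ := hu
    have h1 : shift (wordWeight l) (shift (-wordWeight l) f) = f := by
      rw [shift_shift, add_neg_cancel, shift_zero]
    rw [mul_assoc, ← map_mul, mul_comm g, map_mul, ← mul_assoc, ← mul_assoc, word_mul_cartan, h1]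
  | zero => simp
  | add x y _ _ hx hy => rw [mul_add, add_mul, hx, hy]
  | neg x _ hx => rw [mul_neg, neg_mul, hx]

theorem mul_mem_weightSpace {ν ν' : Fin (m + 1) → ℤ} {u v : Ugl m} (hu : u ∈ weightSpace ν)
    (hv : v ∈ weightSpace ν') : u * v ∈ weightSpace (ν + ν') := by
  induction hu using AddSubgroup.closure_induction with
  | mem u hu =>
    obtain ⟨l, f, rfl, rfl⟩ := hu
    rw [mul_assoc, cartan_mul_of_mem hv, ← mul_assoc]
    induction hv using AddSubgroup.closure_induction with
    | mem v hv =>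
      obtain ⟨l', f', rfl, rfl⟩ := hv
      refine AddSubgroup.subset_closure ⟨l ++ l', f' * shift (-wordWeight l') f, ?_, ?_⟩
      · simp [wordWeight]
      · simp [word, mul_assoc]
    | zero => simp [zero_mem]
    | add x y _ _ hx hy => rw [mul_add, add_mul]; exact add_mem hx hy
    | neg x _ hx => rw [mul_neg, neg_mul]; exact neg_mem hx
  | zero => rw [zero_mul]; exact zero_mem _
  | add x y _ _ hx hy => rw [add_mul]; exact add_mem hx hy
  | neg x _ hx => rw [neg_mul]; exact neg_mem hx

theorem E_mem_weightSpace (a b : Fin (m + 1)) : (E a b : Ugl m) ∈ weightSpace (weight a b) :=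
  AddSubgroup.subset_closure ⟨[(a, b)], 1, by simp [wordWeight], by simp [word]⟩

theorem cartan_mem_weightSpace (f : MvPolynomial (Fin (m + 1)) ℂ) :
    cartan m f ∈ weightSpace (0 : Fin (m + 1) → ℤ) :=
  AddSubgroup.subset_closure ⟨[], f, by simp [wordWeight], by simp [word]⟩

theorem mul_cartan_mem_weightSpace {ν : Fin (m + 1) → ℤ} {u : Ugl m} (hu : u ∈ weightSpace ν)
    (f : MvPolynomial (Fin (m + 1)) ℂ) : u * cartan m f ∈ weightSpace ν := by
  simpa using mul_mem_weightSpace hu (cartan_mem_weightSpace f)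

theorem weight_add_weight (a b c : Fin (m + 1)) : weight a b + weight b c = weight a c := by
  simp [weight]

/-- The height of a weight; it is positive on the positive roots of `gl_m`. -/
noncomputable def height : (Fin (m + 1) → ℤ) →+ ℤ where
  toFun ν := -∑ i : Fin m, (i : ℤ) * ν i.castSucc
  map_zero' := by simp
  map_add' ν ν' := by simp [mul_add, Finset.sum_add_distrib, add_comm]

theorem height_apply (ν : Fin (m + 1) → ℤ) :
    height ν = -∑ i : Fin m, (i : ℤ) * ν i.castSucc := rfl

theorem height_weight (i j : Fin m) :
    height (weight i.castSucc j.castSucc) = (j : ℤ) - i := by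
  simp [height_apply, weight, Pi.single_apply, mul_sub]

theorem height_weight_last (i : Fin m) :
    height (weight i.castSucc (Fin.last m)) = -(i : ℤ) := by
  have (x : Fin m) : x.castSucc ≠ Fin.last m := (Fin.castSucc_lt_last x).ne
  simp [height_apply, weight, Pi.single_apply, this]

theorem height_last_weight (i : Fin m) :
    height (weight (Fin.last m) i.castSucc) = (i : ℤ) := by
  have (x : Fin m) : x.castSucc ≠ Fin.last m := (Fin.castSucc_lt_last x).ne
  simp [height_apply, weight, Pi.single_apply, this]

theorem height_weight_le (a b : Fin (m + 1)) : height (weight a b) ≤ m := by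
  induction a using Fin.lastCases with
  | last =>
    induction b using Fin.lastCases with
    | last => simp [weight]
    | cast j => rw [height_last_weight]; have := j.2; omega
  | cast i =>
    induction b using Fin.lastCases with
    | last => rw [height_weight_last]; omega
    | cast j => rw [height_weight]; have := j.2; omega

theorem height_wordWeight_le (l : List (Fin (m + 1) × Fin (m + 1))) :
    height (wordWeight l) ≤ l.length * m := by
  induction l with
  | nil => simp [wordWeight]
  | cons p l ih =>
    have := height_weight_le p.1 p.2
    simp only [wordWeight, List.map_cons, List.sum_cons, map_add, List.length_cons] at ih ⊢
    push_cast
    linarith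

/-! ### The Casimir element of `gl_m` -/

/-- The quadratic Casimir element of `gl_m`. -/
noncomputable def casimir (m : ℕ) : Ugl m :=
  ∑ i : Fin m, ∑ j : Fin m, E i.castSucc j.castSucc * E j.castSucc i.castSucc

/-- The bracket with each summand gives four Kronecker delta terms. After summation over `i` and
`j`, the terms with `b = i` and `i = a` cancel, and so do those with `j = a` and `b = j`. -/
theorem E_mul_casimir (a b : Fin m) :
    E a.castSucc b.castSucc * casimir m = casimir m * E a.castSucc b.castSucc := by
  have h1 : ∀ i j : Fin m, E a.castSucc b.castSucc * (E i.castSucc j.castSucc *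
        E j.castSucc i.castSucc) = E i.castSucc j.castSucc * E j.castSucc i.castSucc
          * (E a.castSucc b.castSucc : Ugl m)
        + ((if b = i then E a.castSucc j.castSucc * E j.castSucc b.castSucc else 0)
          - (if j = a then E i.castSucc b.castSucc * E a.castSucc i.castSucc else 0)
          + (if b = j then E i.castSucc b.castSucc * E a.castSucc i.castSucc else 0)
          - (if i = a then E a.castSucc j.castSucc * E j.castSucc b.castSucc else 0)) := by
    intro i j
    rw [← mul_assoc, E_mul_E, sub_mul, add_mul, mul_assoc, E_mul_E a.castSucc, mul_sub, mul_add]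
    simp only [Fin.castSucc_inj]
    split_ifs <;> subst_vars <;> simp [mul_assoc] <;> abel
  simp only [casimir, Finset.mul_sum, Finset.sum_mul, h1, Finset.sum_add_distrib,
    Finset.sum_sub_distrib]
  have h2 : ∑ i : Fin m, ∑ j : Fin m, (if b = i then
      (E a.castSucc j.castSucc * E j.castSucc b.castSucc : Ugl m) else 0)
      = ∑ j : Fin m, E a.castSucc j.castSucc * E j.castSucc b.castSucc := by
    rw [Finset.sum_comm]; simp
  have h3 : ∑ i : Fin m, ∑ j : Fin m, (if i = a then
      (E a.castSucc j.castSucc * E j.castSucc b.castSucc : Ugl m) else 0)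
      = ∑ j : Fin m, E a.castSucc j.castSucc * E j.castSucc b.castSucc := by
    rw [Finset.sum_comm]; simp
  rw [h2, h3]
  simp

/-- The Harish-Chandra image of the Casimir element. -/
noncomputable def casimirPoly (m : ℕ) : Uh m :=
  ∑ i, MvPolynomial.X i ^ 2
    + ∑ i, ∑ j, if i < j then MvPolynomial.X i - MvPolynomial.X j else 0

/-- Normal ordering: for `i < j` the product `E_{ij} E_{ji}` is rewritten with the positive root
vector on the right, which costs `E_{ii} - E_{jj}`. -/
theorem casimir_eq : casimir m = cartanSub m (casimirPoly m)
    + ∑ i : Fin m, ∑ j : Fin m, if i < j then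
      2 * (E j.castSucc i.castSucc * E i.castSucc j.castSucc) else 0 := by
  have h1 : ∀ i j : Fin m, (E i.castSucc j.castSucc * E j.castSucc i.castSucc : Ugl m)
      = (if i = j then E i.castSucc i.castSucc ^ 2 else 0)
        + (if i < j then E i.castSucc i.castSucc - E j.castSucc j.castSucc else 0)
        + (if i < j then E j.castSucc i.castSucc * E i.castSucc j.castSucc else 0)
        + (if j < i then E i.castSucc j.castSucc * E j.castSucc i.castSucc else 0) := by
    intro i j
    rcases lt_trichotomy i j with h | h | h
    · rw [E_mul_E]
      simp [h, h.ne, h.not_gt]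
      abel
    · subst h; simp [sq]
    · simp [h, h.ne', h.not_gt]
  rw [casimir, Finset.sum_congr rfl fun i _ => Finset.sum_congr rfl fun j _ => h1 i j]
  simp only [Finset.sum_add_distrib]
  have h2 : ∑ i : Fin m, ∑ j : Fin m, (if j < i then
        (E i.castSucc j.castSucc * E j.castSucc i.castSucc : Ugl m) else 0)
      = ∑ i : Fin m, ∑ j : Fin m, (if i < j then
        (E j.castSucc i.castSucc * E i.castSucc j.castSucc : Ugl m) else 0) := Finset.sum_comm
  have h3 : ∀ (p : Prop) [Decidable p] (f : Uh m), cartanSub m (if p then f else 0)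
      = if p then cartanSub m f else 0 := by
    intro p _ f; split_ifs <;> simp
  have h4 : ∀ (p : Prop) [Decidable p] (f : Ugl m), (if p then 2 * f else 0)
      = (if p then f else 0) + if p then f else 0 := by
    intro p _ f; split_ifs <;> simp [two_mul]
  rw [h2]
  simp only [casimirPoly, map_add, map_sum, h3, map_sub, map_pow, cartanSub_X, h4,
    Finset.sum_add_distrib]
  simp
  abel

/-- The scalar by which the Casimir element acts on a singular vector of weight `ν`. -/
noncomputable def casimirValue (ν : Fin (m + 1) → ℤ) : Uh m :=
  shift (fun i => -ν i.castSucc) (casimirPoly m)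

/-- The quadratic part of `casimirPoly` is a sum of squares, so a translation changes it by a
polynomial of degree at most one whose linear coefficients record the weight. The Casimir value thus
determines the restriction of `ν` to `𝔥`. -/
theorem pderiv_casimirValue_sub (ν ν' : Fin (m + 1) → ℤ) (k : Fin m) :
    MvPolynomial.pderiv k (casimirValue ν - casimirValue ν')
      = MvPolynomial.C (2 * ((ν k.castSucc : ℂ) - ν' k.castSucc)) := by
  have h3 : ∀ (p : Prop) [Decidable p] (w : Fin m → ℤ) (f : Uh m), shift w (if p then f else 0)
      = if p then shift w f else 0 := by
    intro p _ w f; split_ifs <;> simp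
  have h4 : ∀ (p : Prop) [Decidable p] (f : Uh m), MvPolynomial.pderiv k (if p then f else 0)
      = if p then MvPolynomial.pderiv k f else 0 := by
    intro p _ f; split_ifs <;> simp
  simp only [casimirValue, casimirPoly, map_add, map_sum, map_sub, h3, h4, map_pow]
  simp only [shift, MvPolynomial.aeval_X, map_sub, Derivation.leibniz_pow, MvPolynomial.pderiv_C, sub_zero,
    MvPolynomial.pderiv_X]
  simp [Pi.single_apply]
  rw [show (MvPolynomial.C 2 : Uh m) = 2 from map_ofNat _ 2]
  ring

theorem casimirValue_sub_ne_zero {ν ν' : Fin (m + 1) → ℤ} (h : height ν ≠ height ν') :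
    casimirValue ν - casimirValue ν' ≠ 0 := by
  intro h0
  apply h
  rw [height_apply, height_apply]
  congr 1
  refine Finset.sum_congr rfl fun k _ => ?_
  have := pderiv_casimirValue_sub ν ν' k
  rw [h0, map_zero, eq_comm, MvPolynomial.C_eq_zero] at this
  simp only [mul_eq_zero, OfNat.ofNat_ne_zero, false_or, sub_eq_zero, Int.cast_inj] at this
  rw [this]

/-- Subtraction from the Casimir element of its value at the weight `ν`. -/
noncomputable def casimirSub (ν : Fin (m + 1) → ℤ) : Ugl m →+ Ugl m :=
  AddMonoidHom.mulLeft (casimir m) - AddMonoidHom.mulRight (cartanSub m (casimirValue ν))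

theorem casimirSub_apply (ν : Fin (m + 1) → ℤ) (u : Ugl m) :
    casimirSub ν u = casimir m * u - u * cartanSub m (casimirValue ν) := rfl

theorem cartanSub_comm_cartan (f : Uh m) (g : MvPolynomial (Fin (m + 1)) ℂ) :
    cartanSub m f * cartan m g = cartan m g * cartanSub m f := by
  simp only [cartanSub, AlgHom.comp_apply, ← map_mul, mul_comm]

theorem rootIdeal_mul_cartanSub {x : Ugl m} (hx : x ∈ rootIdeal m) (f : Uh m) :
    x * cartanSub m f ∈ rootIdeal m :=
  rootIdeal_mul_cartan hx _

theorem casimirSub_mem {ν : Fin (m + 1) → ℤ} {u : Ugl m} (hu : u ∈ rootIdeal m) :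
    casimirSub ν u ∈ rootIdeal m :=
  sub_mem (Ideal.mul_mem_left _ _ hu) (rootIdeal_mul_cartanSub hu _)

theorem casimirSub_comm (ν ν' : Fin (m + 1) → ℤ) (u : Ugl m) :
    casimirSub ν (casimirSub ν' u) = casimirSub ν' (casimirSub ν u) := by
  have h : cartanSub m (casimirValue ν) * cartanSub m (casimirValue ν')
      = cartanSub m (casimirValue ν') * cartanSub m (casimirValue ν) := by
    rw [← map_mul, mul_comm, map_mul]
  simp only [casimirSub_apply, mul_sub, sub_mul, mul_assoc, h]
  abel

theorem cartanSub_shift_mul {ν : Fin (m + 1) → ℤ} {u : Ugl m} (hu : u ∈ weightSpace ν)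
    (f : Uh m) : cartanSub m f * u = u * cartanSub m (shift (fun i => -ν i.castSucc) f) := by
  simp only [cartanSub, AlgHom.comp_apply]
  rw [cartan_mul_of_mem hu, shift_rename]
  rfl

/-- On weight vectors the Cartan part of the Casimir element is exactly right multiplication by
`casimirValue ν`. Only terms with a positive root vector acting first remain, and these vanish
modulo `J'` on singular elements. -/
theorem casimirSub_of_mem {ν : Fin (m + 1) → ℤ} {u : Ugl m} (hu : u ∈ weightSpace ν) :
    casimirSub ν u = ∑ i : Fin m, ∑ j : Fin m, if i < j then
      2 * (E j.castSucc i.castSucc * (E i.castSucc j.castSucc * u)) else 0 := by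
  rw [casimirSub_apply, casimir_eq, add_mul, cartanSub_shift_mul hu, casimirValue,
    add_sub_cancel_left]
  simp only [Finset.sum_mul, ite_mul, zero_mul, mul_assoc]

/-! ### Elements generated by vectors of larger weight -/

/-- The elements annihilated modulo `J'` by a product of factors `C - c_ν`, where `C` is the
Casimir element and `c_ν` its value at a weight `ν` of height greater than `k`. -/
inductive Higher (k : ℤ) : Ugl m → Prop
  | of_mem (u : Ugl m) : u ∈ rootIdeal m → Higher k u
  | step (ν : Fin (m + 1) → ℤ) (u : Ugl m) : k < height ν → Higher k (casimirSub ν u) → Higher k u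

/-- Supplies the closure properties of `Higher`: left multiplication by `gl_m`, right multiplication
by Cartan polynomials, and the operators `casimirSub` all satisfy the two conditions on `g`. -/
theorem Higher.map {k : ℤ} {u : Ugl m} (hu : Higher k u) (g : Ugl m →+ Ugl m)
    (hg : ∀ x ∈ rootIdeal m, g x ∈ rootIdeal m)
    (hc : ∀ ν x, g (casimirSub ν x) = casimirSub ν (g x)) : Higher k (g u) := by
  induction hu with
  | of_mem u hu => exact .of_mem _ (hg _ hu)
  | step ν u hν _ ih => exact .step ν _ hν (by rwa [← hc])

/-- The operators `casimirSub ν` commute, so the annihilator of `u` followed by that of `v` kills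
the sum. -/
theorem Higher.add {k : ℤ} {u v : Ugl m} (hu : Higher k u) (hv : Higher k v) :
    Higher k (u + v) := by
  induction hu generalizing v with
  | of_mem u hu =>
    induction hv generalizing u with
    | of_mem v hv => exact .of_mem _ (add_mem hu hv)
    | step ν v hν _ ih =>
      refine .step ν _ hν ?_
      rw [map_add]
      exact ih _ (casimirSub_mem hu)
  | step ν u hν _ ih =>
    refine .step ν _ hν ?_
    rw [map_add]
    exact ih (hv.map _ (fun _ hx => casimirSub_mem hx) fun ν' x => casimirSub_comm ν ν' x)

/-- The subgroup of the elements satisfying `Higher k`. -/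
def higher (m : ℕ) (k : ℤ) : AddSubgroup (Ugl m) where
  carrier := {u | Higher k u}
  add_mem' := Higher.add
  zero_mem' := .of_mem _ (zero_mem _)
  neg_mem' {u} hu := by
    have := hu.map (-AddMonoidHom.id _) (fun x hx => by simpa using hx) (by simp)
    simpa using this

theorem higher_of_mem {k : ℤ} {u : Ugl m} (hu : u ∈ rootIdeal m) : u ∈ higher m k :=
  Higher.of_mem _ hu

theorem E_mul_mem_higher {k : ℤ} {u : Ugl m} (hu : u ∈ higher m k) (a b : Fin m) :
    E a.castSucc b.castSucc * u ∈ higher m k := by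
  refine Higher.map hu (AddMonoidHom.mulLeft (E a.castSucc b.castSucc))
    (fun x hx => Ideal.mul_mem_left _ _ hx) fun ν x => ?_
  simp only [AddMonoidHom.coe_mulLeft, casimirSub_apply, mul_sub, ← mul_assoc, E_mul_casimir]

theorem mul_cartan_mem_higher {k : ℤ} {u : Ugl m} (hu : u ∈ higher m k)
    (f : MvPolynomial (Fin (m + 1)) ℂ) : u * cartan m f ∈ higher m k := by
  refine Higher.map hu (AddMonoidHom.mulRight (cartan m f))
    (fun x hx => rootIdeal_mul_cartan hx f) fun ν x => ?_
  simp only [AddMonoidHom.mulRight_apply, casimirSub_apply, sub_mul, mul_assoc,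
    cartanSub_comm_cartan]

/-- The span of the words of length `d` and weight `ν`. -/
def wordSpan (d : ℕ) (ν : Fin (m + 1) → ℤ) : AddSubgroup (Ugl m) :=
  AddSubgroup.closure {u | ∃ l, l.length = d ∧ wordWeight l = ν ∧ u = word l}

theorem E_mul_mem_wordSpan {d : ℕ} {ν : Fin (m + 1) → ℤ} {u : Ugl m} (hu : u ∈ wordSpan d ν)
    (a b : Fin (m + 1)) : E a b * u ∈ wordSpan (d + 1) (weight a b + ν) := by
  induction hu using AddSubgroup.closure_induction with
  | mem u hu =>
    obtain ⟨l, rfl, rfl, rfl⟩ := hu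
    exact AddSubgroup.subset_closure ⟨(a, b) :: l, by simp, by simp [wordWeight], by simp [word]⟩
  | zero => rw [mul_zero]; exact zero_mem _
  | add x y _ _ hx hy => rw [mul_add]; exact add_mem hx hy
  | neg x _ hx => rw [mul_neg]; exact neg_mem hx

theorem word_mem_wordSpan (l : List (Fin (m + 1) × Fin (m + 1))) :
    word l ∈ wordSpan l.length (wordWeight l) :=
  AddSubgroup.subset_closure ⟨l, rfl, rfl, rfl⟩

/-- The adjoint action is a derivation and each bracket of matrix units is a combination of matrix
units, so word length is preserved while the weight is translated. -/
theorem E_bracket_word (a b : Fin (m + 1)) (l : List (Fin (m + 1) × Fin (m + 1))) :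
    E a b * word l - word l * E a b ∈ wordSpan l.length (weight a b + wordWeight l) := by
  induction l with
  | nil => simp [word, zero_mem]
  | cons p l ih =>
    obtain ⟨c, d⟩ := p
    have h1 : E a b * word ((c, d) :: l) - word ((c, d) :: l) * E a b
        = E c d * (E a b * word l - word l * E a b)
          + ((if b = c then E a d * word l else 0) - (if d = a then E c b * word l else 0)) := by
      simp only [word, List.map_cons, List.prod_cons]
      rw [← mul_assoc, E_mul_E]
      simp only [sub_mul, add_mul, ite_mul, zero_mul, mul_sub, mul_assoc]
      abel
    have h2 : wordWeight ((c, d) :: l) = weight c d + wordWeight l := by simp [wordWeight]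
    rw [h1, h2, List.length_cons]
    refine add_mem ?_ (sub_mem ?_ ?_)
    · rw [add_left_comm]
      exact E_mul_mem_wordSpan ih c d
    · split_ifs with h
      · subst h
        rw [← add_assoc, weight_add_weight]
        exact E_mul_mem_wordSpan (word_mem_wordSpan l) _ _
      · exact zero_mem _
    · split_ifs with h
      · subst h
        rw [← add_assoc, add_comm (weight d b), weight_add_weight]
        exact E_mul_mem_wordSpan (word_mem_wordSpan l) _ _
      · exact zero_mem _

theorem E_bracket_mem_wordSpan {d : ℕ} {ν : Fin (m + 1) → ℤ} {u : Ugl m} (hu : u ∈ wordSpan d ν)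
    (a b : Fin (m + 1)) : E a b * u - u * E a b ∈ wordSpan d (weight a b + ν) := by
  induction hu using AddSubgroup.closure_induction with
  | mem u hu =>
    obtain ⟨l, rfl, rfl, rfl⟩ := hu
    exact E_bracket_word a b l
  | zero => simp [zero_mem]
  | add x y _ _ hx hy => rw [mul_add, add_mul, add_sub_add_comm]; exact add_mem hx hy
  | neg x _ hx =>
    have := neg_mem hx
    rwa [neg_sub', ← mul_neg, ← neg_mul] at this

theorem wordSpan_le_weightSpace (d : ℕ) (ν : Fin (m + 1) → ℤ) :
    wordSpan d ν ≤ weightSpace ν := by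
  refine (AddSubgroup.closure_le _).mpr ?_
  rintro _ ⟨l, _, rfl, rfl⟩
  exact AddSubgroup.subset_closure ⟨l, 1, rfl, by simp⟩

/-- Words of length `d` have height at most `d * m`, and a bracket with a positive root vector
raises the height without changing `d`. So the adjoint action of positive roots is nilpotent on
words of given length, and `N` bounds the remaining room below the maximal height. -/
theorem wordSpan_le_higher (k : ℤ) (N : ℕ) : ∀ (d : ℕ) (ν : Fin (m + 1) → ℤ),
    (d : ℤ) * m < height ν + N → k < height ν → wordSpan d ν ≤ higher m k := by
  induction N with
  | zero =>
    intro d ν h _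
    refine (AddSubgroup.closure_le _).mpr ?_
    rintro _ ⟨l, rfl, rfl, rfl⟩
    -- No word has height above `d * m`, so the generating set is empty.
    have := height_wordWeight_le l
    simp only [Nat.cast_zero, add_zero] at h
    omega
  | succ N ih =>
    intro d ν h hk u hu
    refine Higher.step ν u hk ?_
    rw [casimirSub_of_mem (wordSpan_le_weightSpace d ν hu)]
    change _ ∈ higher m k
    refine sum_mem fun i _ => sum_mem fun j _ => ?_
    split_ifs with hij
    · have hlt := Fin.lt_def.mp hij
      have hh := height_weight i j
      rw [two_mul]
      have h1 : E i.castSucc j.castSucc * u ∈ higher m k := by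
        -- Write `e u = [e, u] + u e`: the second term lies in the left ideal, and the first has the
        -- same length and height larger by `j - i ≥ 1`, so the induction hypothesis applies.
        rw [← sub_add_cancel (E i.castSucc j.castSucc * u) (u * E i.castSucc j.castSucc)]
        refine add_mem ?_ (higher_of_mem (Ideal.mul_mem_left _ _ (E_mem_rootIdeal hij)))
        refine ih d _ ?_ ?_ (E_bracket_mem_wordSpan hu _ _)
        · rw [map_add]; push_cast at h; omega
        · rw [map_add]; omega
      exact add_mem (E_mul_mem_higher h1 _ _) (E_mul_mem_higher h1 _ _)
    · exact zero_mem _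

theorem weightSpace_le_higher {k : ℤ} {ν : Fin (m + 1) → ℤ} (h : k < height ν) :
    weightSpace ν ≤ higher m k := by
  refine (AddSubgroup.closure_le _).mpr ?_
  rintro _ ⟨l, f, rfl, rfl⟩
  refine mul_cartan_mem_higher ?_ f
  refine wordSpan_le_higher k (l.length * m - height (wordWeight l) + 1).toNat _ _ ?_ h
    (word_mem_wordSpan l)
  have := height_wordWeight_le l
  omega

/-- A singular vector generated by vectors of larger weight vanishes modulo `J'`. -/
theorem IsSingular.mem_rootIdeal {ν : Fin (m + 1) → ℤ} {v : Ugl m} (hs : IsSingular v)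
    (hv : v ∈ weightSpace ν) (hh : v ∈ higher m (height ν)) : v ∈ rootIdeal m := by
  -- For singular `v` the Casimir element acts by the value `c_ν` itself, modulo `J'`.
  have hc : casimirSub ν v ∈ rootIdeal m := by
    rw [casimirSub_of_mem hv]
    refine sum_mem fun i _ => sum_mem fun j _ => ?_
    split_ifs with hij
    · exact Ideal.mul_mem_left _ _ (Ideal.mul_mem_left _ _ (hs i j hij))
    · exact zero_mem _
  -- The invariant of the induction is `u ≡ v g` modulo `J'` with `g ≠ 0`. Each factor `C - c_ν'`
  -- replaces `g` by `g (c_ν - c_ν')`; at the end `v g ∈ J'` and `g` is cancelled.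
  suffices H : ∀ u : Ugl m, Higher (height ν) u → ∀ g : Uh m, g ≠ 0 →
      u - v * cartanSub m g ∈ rootIdeal m → v ∈ rootIdeal m from
    H v hh 1 one_ne_zero (by simp)
  intro u hu
  induction hu with
  | of_mem u hu =>
    intro g hg h
    exact mem_rootIdeal_of_mul_cartanSub hg (by simpa using sub_mem hu h)
  | step ν' u hν' _ ih =>
    intro g hg h
    refine ih (g * (casimirValue ν - casimirValue ν'))
      (mul_ne_zero hg (casimirValue_sub_ne_zero hν'.ne)) ?_
    have e : casimirSub ν' u - v * cartanSub m (g * (casimirValue ν - casimirValue ν'))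
        = casimirSub ν' (u - v * cartanSub m g) + casimirSub ν v * cartanSub m g := by
      rw [map_sub, casimirSub_apply ν' (v * _), casimirSub_apply ν v, map_mul, map_sub,
        mul_assoc v, sub_mul, mul_assoc v, mul_sub, ← map_mul, ← map_mul, ← map_mul,
        mul_comm _ g, mul_assoc]
      noncomm_ring
    rw [e]
    exact add_mem (casimirSub_mem h) (rootIdeal_mul_cartanSub hc g)

/-! ### Raising and lowering operators with a parameter -/

/-- A nonempty subset is sorted by its least element `k`, which is the first index of the
corresponding word. -/
theorem sum_powerset_Ioi {α M : Type*} [LinearOrder α] [LocallyFiniteOrderTop α]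
    [AddCommMonoid M] (i : α) (F : Finset α → M) :
    ∑ I ∈ (Finset.Ioi i).powerset, F I
      = F ∅ + ∑ k ∈ Finset.Ioi i, ∑ I ∈ (Finset.Ioi k).powerset, F (insert k I) := by
  have hnot : ∀ (k : α) (I : Finset α), I ∈ (Finset.Ioi k).powerset → k ∉ I := by
    intro k I hI hk
    exact lt_irrefl k (Finset.mem_Ioi.mp (Finset.mem_powerset.mp hI hk))
  have hle : ∀ (k l : α) (I I' : Finset α), I ∈ (Finset.Ioi k).powerset →
      insert k I = insert l I' → k ≤ l := by
    intro k l I I' hI h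
    have : l ∈ insert k I := h ▸ Finset.mem_insert_self _ _
    rcases Finset.mem_insert.mp this with h1 | h1
    · exact h1.ge
    · exact (Finset.mem_Ioi.mp (Finset.mem_powerset.mp hI h1)).le
  have h1 : (Finset.Ioi i).powerset = insert ∅ ((Finset.Ioi i).biUnion fun k =>
      (Finset.Ioi k).powerset.image (insert k)) := by
    ext I
    simp only [Finset.mem_powerset, Finset.mem_insert, Finset.mem_biUnion, Finset.mem_image]
    constructor
    · intro hI
      rcases I.eq_empty_or_nonempty with h | h
      · exact Or.inl h
      · refine Or.inr ⟨I.min' h, hI (I.min'_mem h), I.erase (I.min' h), ?_,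
          Finset.insert_erase (I.min'_mem h)⟩
        intro x hx
        exact Finset.mem_Ioi.mpr (lt_of_le_of_ne (I.min'_le x (Finset.mem_of_mem_erase hx))
          (Finset.ne_of_mem_erase hx).symm)
    · rintro (rfl | ⟨k, hk, I, hI, rfl⟩)
      · simp
      · intro x hx
        rcases Finset.mem_insert.mp hx with rfl | hx
        · exact hk
        · exact Finset.mem_Ioi.mpr ((Finset.mem_Ioi.mp hk).trans (Finset.mem_Ioi.mp (hI hx)))
  rw [h1, Finset.sum_insert, Finset.sum_biUnion]
  · congr 1
    refine Finset.sum_congr rfl fun k _ => Finset.sum_image fun I hI I' hI' h => ?_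
    rw [← Finset.erase_insert (hnot k I hI), h, Finset.erase_insert (hnot k I' hI')]
  · intro k _ l _ hkl
    rw [Function.onFun, Finset.disjoint_left]
    intro J hJ hJ'
    obtain ⟨I, hI, rfl⟩ := Finset.mem_image.mp hJ
    obtain ⟨I', hI', h⟩ := Finset.mem_image.mp hJ'
    exact hkl (le_antisymm (hle _ _ _ _ hI h.symm) (hle _ _ _ _ hI' h))
  · simp

theorem sum_powerset_Iio {α M : Type*} [LinearOrder α] [LocallyFiniteOrderBot α]
    [AddCommMonoid M] (i : α) (F : Finset α → M) :
    ∑ I ∈ (Finset.Iio i).powerset, F I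
      = F ∅ + ∑ k ∈ Finset.Iio i, ∑ I ∈ (Finset.Iio k).powerset, F (insert k I) :=
  sum_powerset_Ioi (α := αᵒᵈ) i F

/-- The product of the `f - h_j` over `j ∈ s`. -/
noncomputable def diffProd (f : MvPolynomial (Fin (m + 1)) ℂ) (s : Finset (Fin m)) :
    MvPolynomial (Fin (m + 1)) ℂ :=
  ∏ j ∈ s, (f - h j.castSucc)

/-- The lowering operator, with `h_i` replaced by `f` in the factors `h_i - h_j`. -/
noncomputable def lowerAt (f : MvPolynomial (Fin (m + 1)) ℂ) (i : Fin m) : Ugl m :=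
  ∑ I ∈ (Finset.Ioi i).powerset, loweringWord i (I.sort (· ≤ ·)) *
    cartan m (diffProd f (Finset.Ioi i \ I))

/-- The raising operator, with `h_i` replaced by `f` in the factors `h_i - h_j`. -/
noncomputable def raiseAt (f : MvPolynomial (Fin (m + 1)) ℂ) (i : Fin m) : Ugl m :=
  ∑ I ∈ (Finset.Iio i).powerset, raisingWord i (I.sort (· ≥ ·)) *
    cartan m (diffProd f (Finset.Iio i \ I))

theorem lowering_eq (i : Fin m) : lowering i = lowerAt (h i.castSucc) i := rfl

theorem raising_eq (i : Fin m) : raising i = raiseAt (h i.castSucc) i := rfl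

/-- Splits off the first index `k` of the word. The tail still carries the factors `f - h_j` with
the same `f`; this is why `h_i` is replaced by an independent parameter, as the recursion would not
close on `lowering` itself. -/
theorem lowerAt_rec (f : MvPolynomial (Fin (m + 1)) ℂ) (i : Fin m) :
    lowerAt f i = E (Fin.last m) i.castSucc * cartan m (diffProd f (Finset.Ioi i))
      + ∑ k ∈ Finset.Ioi i, E k.castSucc i.castSucc * lowerAt f k
        * cartan m (diffProd f (Finset.Ioo i k)) := by
  rw [lowerAt, sum_powerset_Ioi]
  congr 1
  · simp [loweringWord]
  · refine Finset.sum_congr rfl fun k hk => ?_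
    rw [lowerAt, Finset.mul_sum, Finset.sum_mul]
    refine Finset.sum_congr rfl fun I hI => ?_
    have hI' : ∀ b ∈ I, k < b := fun b hb =>
      Finset.mem_Ioi.mp (Finset.mem_powerset.mp hI hb)
    have hk' := Finset.mem_Ioi.mp hk
    rw [Finset.sort_insert _ (fun b hb => (hI' b hb).le) (fun h => lt_irrefl _ (hI' k h)),
      loweringWord]
    have hu : Finset.Ioi i \ insert k I = (Finset.Ioi k \ I) ∪ Finset.Ioo i k := by
      ext x
      simp only [Finset.mem_sdiff, Finset.mem_Ioi, Finset.mem_insert, Finset.mem_union,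
        Finset.mem_Ioo]
      have := hI' x
      grind
    have hd : Disjoint (Finset.Ioi k \ I) (Finset.Ioo i k) := by
      rw [Finset.disjoint_left]
      intro x hx hx'
      exact lt_asymm (Finset.mem_Ioi.mp (Finset.mem_sdiff.mp hx).1) (Finset.mem_Ioo.mp hx').2
    rw [hu, diffProd, Finset.prod_union hd, map_mul]
    simp only [mul_assoc, diffProd]

theorem raiseAt_rec (f : MvPolynomial (Fin (m + 1)) ℂ) (i : Fin m) :
    raiseAt f i = E i.castSucc (Fin.last m) * cartan m (diffProd f (Finset.Iio i))
      + ∑ k ∈ Finset.Iio i, E i.castSucc k.castSucc * raiseAt f k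
        * cartan m (diffProd f (Finset.Ioo k i)) := by
  rw [raiseAt, sum_powerset_Iio]
  congr 1
  · simp [raisingWord]
  · refine Finset.sum_congr rfl fun k hk => ?_
    rw [raiseAt, Finset.mul_sum, Finset.sum_mul]
    refine Finset.sum_congr rfl fun I hI => ?_
    have hI' : ∀ b ∈ I, b < k := fun b hb =>
      Finset.mem_Iio.mp (Finset.mem_powerset.mp hI hb)
    have hk' := Finset.mem_Iio.mp hk
    rw [Finset.sort_insert _ (fun b hb => (hI' b hb).le) (fun h => lt_irrefl _ (hI' k h)),
      raisingWord]
    have hu : Finset.Iio i \ insert k I = (Finset.Iio k \ I) ∪ Finset.Ioo k i := by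
      ext x
      simp only [Finset.mem_sdiff, Finset.mem_Iio, Finset.mem_insert, Finset.mem_union,
        Finset.mem_Ioo]
      have := hI' x
      grind
    have hd : Disjoint (Finset.Iio k \ I) (Finset.Ioo k i) := by
      rw [Finset.disjoint_left]
      intro x hx hx'
      exact lt_asymm (Finset.mem_Iio.mp (Finset.mem_sdiff.mp hx).1) (Finset.mem_Ioo.mp hx').1
    rw [hu, diffProd, Finset.prod_union hd, map_mul]
    simp only [mul_assoc, diffProd]

theorem lowerAt_mem_weightSpace (f : MvPolynomial (Fin (m + 1)) ℂ) (i : Fin m) :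
    lowerAt f i ∈ weightSpace (weight (Fin.last m) i.castSucc) := by
  have hw : ∀ (l : List (Fin m)) (i : Fin m),
      loweringWord i l ∈ weightSpace (weight (Fin.last m) i.castSucc) := by
    intro l
    induction l with
    | nil => intro i; exact E_mem_weightSpace _ _
    | cons k l ih =>
      intro i
      rw [← weight_add_weight _ k.castSucc, add_comm (weight (Fin.last m) _)]
      exact mul_mem_weightSpace (E_mem_weightSpace _ _) (ih k)
  exact sum_mem fun I _ => mul_cartan_mem_weightSpace (hw _ _) _

theorem raiseAt_mem_weightSpace (f : MvPolynomial (Fin (m + 1)) ℂ) (i : Fin m) :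
    raiseAt f i ∈ weightSpace (weight i.castSucc (Fin.last m)) := by
  have hw : ∀ (l : List (Fin m)) (i : Fin m),
      raisingWord i l ∈ weightSpace (weight i.castSucc (Fin.last m)) := by
    intro l
    induction l with
    | nil => intro i; exact E_mem_weightSpace _ _
    | cons k l ih =>
      intro i
      rw [← weight_add_weight _ k.castSucc]
      exact mul_mem_weightSpace (E_mem_weightSpace _ _) (ih k)
  exact sum_mem fun I _ => mul_cartan_mem_weightSpace (hw _ _) _

/-! ### Singularity of the raising and lowering operators -/

theorem E_mul_lowerAt (f : MvPolynomial (Fin (m + 1)) ℂ) (a b i : Fin m) :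
    E a.castSucc b.castSucc * lowerAt f i
      = E (Fin.last m) i.castSucc * E a.castSucc b.castSucc
          * cartan m (diffProd f (Finset.Ioi i))
        - (if i = a then E (Fin.last m) b.castSucc * cartan m (diffProd f (Finset.Ioi i)) else 0)
        + ∑ k ∈ Finset.Ioi i, (E k.castSucc i.castSucc * (E a.castSucc b.castSucc * lowerAt f k)
            * cartan m (diffProd f (Finset.Ioo i k))
          + (if b = k then E a.castSucc i.castSucc * lowerAt f k
            * cartan m (diffProd f (Finset.Ioo i k)) else 0)
          - (if i = a then E k.castSucc b.castSucc * lowerAt f k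
            * cartan m (diffProd f (Finset.Ioo i k)) else 0)) := by
  conv_lhs => rw [lowerAt_rec, mul_add, Finset.mul_sum]
  congr 1
  · rw [← mul_assoc, E_mul_E, if_neg (Fin.castSucc_lt_last b).ne]
    simp only [Fin.castSucc_inj, add_zero, sub_mul, ite_mul, zero_mul]
  · refine Finset.sum_congr rfl fun k _ => ?_
    rw [← mul_assoc, ← mul_assoc, E_mul_E]
    simp only [Fin.castSucc_inj, sub_mul, add_mul, ite_mul, zero_mul, mul_assoc]

theorem E_mul_raiseAt (f : MvPolynomial (Fin (m + 1)) ℂ) (a b i : Fin m) :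
    E a.castSucc b.castSucc * raiseAt f i
      = E i.castSucc (Fin.last m) * E a.castSucc b.castSucc
          * cartan m (diffProd f (Finset.Iio i))
        + (if b = i then E a.castSucc (Fin.last m) * cartan m (diffProd f (Finset.Iio i)) else 0)
        + ∑ k ∈ Finset.Iio i, (E i.castSucc k.castSucc * (E a.castSucc b.castSucc * raiseAt f k)
            * cartan m (diffProd f (Finset.Ioo k i))
          + (if b = i then E a.castSucc k.castSucc * raiseAt f k
            * cartan m (diffProd f (Finset.Ioo k i)) else 0)
          - (if k = a then E i.castSucc b.castSucc * raiseAt f k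
            * cartan m (diffProd f (Finset.Ioo k i)) else 0)) := by
  conv_lhs => rw [raiseAt_rec, mul_add, Finset.mul_sum]
  congr 1
  · rw [← mul_assoc, E_mul_E, if_neg (Fin.castSucc_lt_last a).ne']
    simp only [Fin.castSucc_inj, sub_zero, add_mul, ite_mul, zero_mul]
  · refine Finset.sum_congr rfl fun k _ => ?_
    rw [← mul_assoc, ← mul_assoc, E_mul_E]
    simp only [Fin.castSucc_inj, sub_mul, add_mul, ite_mul, zero_mul, mul_assoc]

theorem diffProd_insert (f : MvPolynomial (Fin (m + 1)) ℂ) {s : Finset (Fin m)} {a : Fin m}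
    (ha : a ∉ s) : diffProd f (insert a s) = (f - h a.castSucc) * diffProd f s :=
  Finset.prod_insert ha

theorem Ioi_eq_insert {a b : Fin m} (hab : (b : ℕ) = a + 1) :
    Finset.Ioi a = insert b (Finset.Ioi b) := by
  ext x; simp only [Finset.mem_Ioi, Finset.mem_insert, Fin.lt_def, Fin.ext_iff]; omega

theorem Iio_eq_insert {a b : Fin m} (hab : (b : ℕ) = a + 1) :
    Finset.Iio b = insert a (Finset.Iio a) := by
  ext x; simp only [Finset.mem_Iio, Finset.mem_insert, Fin.lt_def, Fin.ext_iff]; omega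

theorem Ioo_eq_insert_left {a b k : Fin m} (hab : (b : ℕ) = a + 1) (hk : b < k) :
    Finset.Ioo a k = insert b (Finset.Ioo b k) := by
  have := Fin.lt_def.mp hk
  ext x; simp only [Finset.mem_Ioo, Finset.mem_insert, Fin.lt_def, Fin.ext_iff]; omega

theorem Ioo_eq_insert_right {a b k : Fin m} (hab : (b : ℕ) = a + 1) (hk : k < a) :
    Finset.Ioo k b = insert a (Finset.Ioo k a) := by
  have := Fin.lt_def.mp hk
  ext x; simp only [Finset.mem_Ioo, Finset.mem_insert, Fin.lt_def, Fin.ext_iff]; omega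

theorem Ioo_succ {a b : Fin m} (hab : (b : ℕ) = a + 1) : Finset.Ioo a b = ∅ := by
  ext x
  simp only [Finset.mem_Ioo, Fin.lt_def, Finset.notMem_empty, iff_false]
  omega

theorem cartan_h (a : Fin (m + 1)) : cartan m (h a) = E a a - ((a : ℕ) : Ugl m) := by
  rw [h, map_sub, cartan_X]
  simp

theorem weight_apply (a b c : Fin (m + 1)) :
    weight a b c = (if c = a then 1 else 0) - (if c = b then 1 else 0) := by
  simp [weight, Pi.single_apply]

theorem shift_neg_h {w : Fin (m + 1) → ℤ} (a : Fin (m + 1)) :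
    shift (-w) (h a) = h a + MvPolynomial.C (w a : ℂ) := by
  simp only [shift, h, map_sub, MvPolynomial.aeval_X, MvPolynomial.algHom_C,
    MvPolynomial.algebraMap_eq, Pi.neg_apply, Int.cast_neg, map_neg]
  ring

theorem E_diag_mul {ν : Fin (m + 1) → ℤ} {u : Ugl m} (hu : u ∈ weightSpace ν) (a : Fin (m + 1)) :
    E a a * u = u * cartan m (h a + MvPolynomial.C (((a : ℕ) : ℂ) + ν a)) := by
  have h1 : (E a a : Ugl m) = cartan m (h a + MvPolynomial.C ((a : ℕ) : ℂ)) := by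
    rw [h, sub_add_cancel, cartan_X]
  rw [h1, cartan_mul_of_mem hu, map_add, shift_neg_h, MvPolynomial.C_add,
    ← MvPolynomial.algebraMap_eq, AlgHom.commutes]
  congr 2
  ring

/-- Moving `E_{aa} - E_{bb}` past `u` adds `ν_a - ν_b = 1`, which is exactly the difference between
`h_a - h_b` and `E_{aa} - E_{bb}`. -/
theorem E_diag_sub_mul {ν : Fin (m + 1) → ℤ} {u : Ugl m} (hu : u ∈ weightSpace ν) {a b : Fin m}
    (hab : (b : ℕ) = a + 1) (hν : ν a.castSucc = ν b.castSucc + 1) :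
    E a.castSucc a.castSucc * u - E b.castSucc b.castSucc * u
      = u * cartan m (h a.castSucc - h b.castSucc) := by
  rw [E_diag_mul hu, E_diag_mul hu, ← mul_sub, ← map_sub]
  congr 2
  rw [hν, Fin.val_castSucc, Fin.val_castSucc, hab, add_sub_add_comm, ← map_sub]
  push_cast
  rw [show (a : ℂ) + (ν b.castSucc + 1) - (a + 1 + ν b.castSucc) = 0 by ring]
  simp

/-- The only obstruction to singularity is the factor `h_a - f` when `i = a`, and it vanishes at `f
= h_i`. The proof is a downward induction on `i` through `lowerAt_rec`. -/
theorem E_succ_mul_lowerAt (f : MvPolynomial (Fin (m + 1)) ℂ) {a b : Fin m}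
    (hab : (b : ℕ) = a + 1) (i : Fin m) :
    E a.castSucc b.castSucc * lowerAt f i
      - (if i = a then lowerAt f b * cartan m (h a.castSucc - f) else 0) ∈ rootIdeal m := by
  have hlt : a < b := Fin.lt_def.mpr (by omega)
  have hJ : E a.castSucc b.castSucc ∈ rootIdeal m := E_mem_rootIdeal hlt
  induction i using WellFoundedGT.induction with
  | ind i ih =>
  have h0 : E (Fin.last m) i.castSucc * E a.castSucc b.castSucc
      * cartan m (diffProd f (Finset.Ioi i)) ∈ rootIdeal m :=
    rootIdeal_mul_cartan (Ideal.mul_mem_left _ _ hJ) _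
  rw [E_mul_lowerAt]
  by_cases hia : i = a
  · subst hia
    have h1 : ∀ k ∈ Finset.Ioi i, E k.castSucc i.castSucc * (E i.castSucc b.castSucc
        * lowerAt f k) * cartan m (diffProd f (Finset.Ioo i k)) ∈ rootIdeal m := by
      intro k hk
      have := ih k (Finset.mem_Ioi.mp hk)
      rw [if_neg (Finset.mem_Ioi.mp hk).ne', sub_zero] at this
      exact rootIdeal_mul_cartan (Ideal.mul_mem_left _ _ this) _
    have h2 := E_diag_sub_mul (lowerAt_mem_weightSpace f b) hab (by
      have h3 : i.castSucc ≠ b.castSucc := by simp [hlt.ne]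
      simp [weight_apply, h3, (Fin.castSucc_lt_last _).ne])
    have h3 : lowerAt f b * cartan m (f - h b.castSucc)
        = E (Fin.last m) b.castSucc * cartan m (diffProd f (Finset.Ioi i))
          + ∑ k ∈ Finset.Ioi b, E k.castSucc b.castSucc * lowerAt f k
            * cartan m (diffProd f (Finset.Ioo i k)) := by
      conv_lhs => rw [lowerAt_rec, add_mul, Finset.sum_mul]
      congr 1
      · rw [mul_assoc, ← map_mul, Ioi_eq_insert hab, diffProd_insert _ (by simp), mul_comm]
      · refine Finset.sum_congr rfl fun k hk => ?_
        rw [mul_assoc _ (cartan m _), ← map_mul, Ioo_eq_insert_left hab (Finset.mem_Ioi.mp hk),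
          diffProd_insert _ (by simp), mul_comm (f - _)]
    simp only [if_true, Finset.sum_add_distrib, Finset.sum_sub_distrib]
    rw [Finset.sum_ite_eq, if_pos (Finset.mem_Ioi.mpr hlt)]
    have h4 : ∑ k ∈ Finset.Ioi i, E k.castSucc b.castSucc * lowerAt f k
            * cartan m (diffProd f (Finset.Ioo i k))
        = E b.castSucc b.castSucc * lowerAt f b + ∑ k ∈ Finset.Ioi b, E k.castSucc b.castSucc
            * lowerAt f k * cartan m (diffProd f (Finset.Ioo i k)) := by
      rw [Ioi_eq_insert hab, Finset.sum_insert (by simp), Ioo_succ hab]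
      simp [diffProd]
    have h5 : h i.castSucc - f = (h i.castSucc - h b.castSucc) - (f - h b.castSucc) := by ring
    -- The part `h_a - h_b` comes from the two diagonal terms produced at `k = b`. The part `f -
    -- h_b` restores the factor that `diffProd` gains when `b` is added to the interval, so that the
    -- recursion for `lowerAt f b` reappears.
    rw [h4, h5, map_sub (cartan m) (h i.castSucc - h b.castSucc), mul_sub, ← h2, h3, Ioo_succ hab]
    have h6 := add_mem h0 (sum_mem h1)
    convert h6 using 1
    simp only [diffProd, Finset.prod_empty, map_one, mul_one]
    abel
  · simp only [if_neg hia, sub_zero]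
    refine add_mem h0 ?_
    have h1 : ∀ k ∈ Finset.Ioi i, E k.castSucc i.castSucc * (E a.castSucc b.castSucc
        * lowerAt f k) * cartan m (diffProd f (Finset.Ioo i k))
        - (if k = a then E a.castSucc i.castSucc * (lowerAt f b * cartan m (h a.castSucc - f))
          * cartan m (diffProd f (Finset.Ioo i k)) else 0) ∈ rootIdeal m := by
      intro k hk
      have := rootIdeal_mul_cartan (Ideal.mul_mem_left _ (E k.castSucc i.castSucc)
        (ih k (Finset.mem_Ioi.mp hk))) (diffProd f (Finset.Ioo i k))
      split_ifs with h
      · subst h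
        simpa [mul_sub, sub_mul] using this
      · simpa [h] using this
    have h2 := sum_mem h1
    rw [Finset.sum_sub_distrib, Finset.sum_ite_eq'] at h2
    rw [Finset.sum_add_distrib, Finset.sum_ite_eq]
    convert h2 using 1
    rw [sub_eq_add_neg]
    congr 1
    -- For `i < a` there are two contributions, the bracket with `E_{ki}` at `k = b` and the
    -- induction hypothesis at `k = a`. They cancel because the interval from `i` to `b` has one
    -- more factor, `f - h_a`, than the interval from `i` to `a`. For `i > a` neither index occurs
    -- in the sum.
    rcases lt_or_gt_of_ne hia with hi | hi
    · rw [if_pos (Finset.mem_Ioi.mpr (hi.trans hlt)), if_pos (Finset.mem_Ioi.mpr hi),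
        Ioo_eq_insert_right hab hi, diffProd_insert _ (by simp), ← neg_sub f (h a.castSucc),
        map_mul, map_neg]
      noncomm_ring
    · have hb : ¬ i < b := by rw [Fin.lt_def] at hi ⊢; omega
      rw [if_neg (by simpa using hb), if_neg (by simpa using hi.le), neg_zero]

/-- Mirror image of `E_succ_mul_lowerAt`, by upward induction: the obstruction sits at `i = b` and
is `f - h_b`. -/
theorem E_succ_mul_raiseAt (f : MvPolynomial (Fin (m + 1)) ℂ) {a b : Fin m}
    (hab : (b : ℕ) = a + 1) (i : Fin m) :
    E a.castSucc b.castSucc * raiseAt f i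
      - (if i = b then raiseAt f a * cartan m (f - h b.castSucc) else 0) ∈ rootIdeal m := by
  have hlt : a < b := Fin.lt_def.mpr (by omega)
  have hJ : E a.castSucc b.castSucc ∈ rootIdeal m := E_mem_rootIdeal hlt
  induction i using WellFoundedLT.induction with
  | ind i ih =>
  have h0 : E i.castSucc (Fin.last m) * E a.castSucc b.castSucc
      * cartan m (diffProd f (Finset.Iio i)) ∈ rootIdeal m :=
    rootIdeal_mul_cartan (Ideal.mul_mem_left _ _ hJ) _
  rw [E_mul_raiseAt]
  by_cases hia : b = i
  · subst hia
    have h1 : ∀ k ∈ Finset.Iio b, E b.castSucc k.castSucc * (E a.castSucc b.castSucc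
        * raiseAt f k) * cartan m (diffProd f (Finset.Ioo k b)) ∈ rootIdeal m := by
      intro k hk
      have := ih k (Finset.mem_Iio.mp hk)
      rw [if_neg (Finset.mem_Iio.mp hk).ne, sub_zero] at this
      exact rootIdeal_mul_cartan (Ideal.mul_mem_left _ _ this) _
    have h2 := E_diag_sub_mul (raiseAt_mem_weightSpace f a) hab (by
      have h3 : b.castSucc ≠ a.castSucc := by simp [hlt.ne']
      simp [weight_apply, h3, (Fin.castSucc_lt_last _).ne])
    have h3 : raiseAt f a * cartan m (f - h a.castSucc)
        = E a.castSucc (Fin.last m) * cartan m (diffProd f (Finset.Iio b))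
          + ∑ k ∈ Finset.Iio a, E a.castSucc k.castSucc * raiseAt f k
            * cartan m (diffProd f (Finset.Ioo k b)) := by
      conv_lhs => rw [raiseAt_rec, add_mul, Finset.sum_mul]
      congr 1
      · rw [mul_assoc, ← map_mul, Iio_eq_insert hab, diffProd_insert _ (by simp), mul_comm]
      · refine Finset.sum_congr rfl fun k hk => ?_
        rw [mul_assoc _ (cartan m _), ← map_mul, Ioo_eq_insert_right hab (Finset.mem_Iio.mp hk),
          diffProd_insert _ (by simp), mul_comm (f - _)]
    simp only [if_true, Finset.sum_add_distrib, Finset.sum_sub_distrib]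
    rw [Finset.sum_ite_eq', if_pos (Finset.mem_Iio.mpr hlt)]
    have h4 : ∑ k ∈ Finset.Iio b, E a.castSucc k.castSucc * raiseAt f k
            * cartan m (diffProd f (Finset.Ioo k b))
        = E a.castSucc a.castSucc * raiseAt f a + ∑ k ∈ Finset.Iio a, E a.castSucc k.castSucc
            * raiseAt f k * cartan m (diffProd f (Finset.Ioo k b)) := by
      rw [Iio_eq_insert hab, Finset.sum_insert (by simp), Ioo_succ hab]
      simp [diffProd]
    have h5 : f - h b.castSucc = (h a.castSucc - h b.castSucc) + (f - h a.castSucc) := by ring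
    rw [h4, h5, map_add (cartan m) (h a.castSucc - h b.castSucc), mul_add, ← h2, h3, Ioo_succ hab]
    have h6 := add_mem h0 (sum_mem h1)
    convert h6 using 1
    simp only [diffProd, Finset.prod_empty, map_one, mul_one]
    abel
  · simp only [if_neg hia, if_neg (Ne.symm hia), add_zero, sub_zero]
    refine add_mem h0 ?_
    have h1 : ∀ k ∈ Finset.Iio i, E i.castSucc k.castSucc * (E a.castSucc b.castSucc
        * raiseAt f k) * cartan m (diffProd f (Finset.Ioo k i))
        - (if k = b then E i.castSucc b.castSucc * (raiseAt f a * cartan m (f - h b.castSucc))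
          * cartan m (diffProd f (Finset.Ioo k i)) else 0) ∈ rootIdeal m := by
      intro k hk
      have := rootIdeal_mul_cartan (Ideal.mul_mem_left _ (E i.castSucc k.castSucc)
        (ih k (Finset.mem_Iio.mp hk))) (diffProd f (Finset.Ioo k i))
      split_ifs with h
      · subst h
        simpa [mul_sub, sub_mul] using this
      · simpa [h] using this
    have h2 := sum_mem h1
    rw [Finset.sum_sub_distrib, Finset.sum_ite_eq'] at h2
    rw [Finset.sum_sub_distrib, Finset.sum_ite_eq']
    convert h2 using 1
    congr 1
    rcases lt_or_gt_of_ne hia with hi | hi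
    · rw [if_pos (Finset.mem_Iio.mpr (hlt.trans hi)), if_pos (Finset.mem_Iio.mpr hi),
        Ioo_eq_insert_left hab hi, diffProd_insert _ (by simp), map_mul]
      noncomm_ring
    · have hb : ¬ a < i := by rw [Fin.lt_def] at hi ⊢; omega
      rw [if_neg (by simpa using hb), if_neg (by simpa using hi.le)]

theorem isSingular_lowering (i : Fin m) : IsSingular (lowering i) := by
  refine isSingular_of_succ fun a b hab => ?_
  have := E_succ_mul_lowerAt (h i.castSucc) hab i
  rw [lowering_eq]
  split_ifs at this with h
  · subst h; simpa using this
  · simpa using this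

theorem isSingular_raising (i : Fin m) : IsSingular (raising i) := by
  refine isSingular_of_succ fun a b hab => ?_
  have := E_succ_mul_raiseAt (h i.castSucc) hab i
  rw [raising_eq]
  split_ifs at this with h
  · subst h; simpa using this
  · simpa using this

/-! ### Products over intervals -/

theorem prod_Ioi_split {α M : Type*} [LinearOrder α] [LocallyFiniteOrder α]
    [LocallyFiniteOrderTop α] [CommMonoid M] {i j : α} (hij : i < j) (F : α → M) :
    ∏ k ∈ Finset.Ioi i, F k = (∏ k ∈ Finset.Ioo i j, F k) * F j * ∏ k ∈ Finset.Ioi j, F k := by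
  have h1 : Finset.Ioi i = (insert j (Finset.Ioo i j)) ∪ Finset.Ioi j := by
    ext x; simp only [Finset.mem_Ioi, Finset.mem_union, Finset.mem_insert, Finset.mem_Ioo]; grind
  rw [h1, Finset.prod_union, Finset.prod_insert (by simp), mul_comm (F j)]
  rw [Finset.disjoint_left]
  intro x hx hx'
  simp only [Finset.mem_Ioi, Finset.mem_insert, Finset.mem_Ioo] at hx hx'
  grind

theorem prod_Iio_split {α M : Type*} [LinearOrder α] [LocallyFiniteOrder α]
    [LocallyFiniteOrderBot α] [CommMonoid M] {i j : α} (hij : i < j) (F : α → M) :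
    ∏ k ∈ Finset.Iio j, F k = (∏ k ∈ Finset.Iio i, F k) * F i * ∏ k ∈ Finset.Ioo i j, F k := by
  have h1 : Finset.Iio j = (insert i (Finset.Iio i)) ∪ Finset.Ioo i j := by
    ext x; simp only [Finset.mem_Iio, Finset.mem_union, Finset.mem_insert, Finset.mem_Ioo]; grind
  rw [h1, Finset.prod_union, Finset.prod_insert (by simp), mul_comm (F i)]
  rw [Finset.disjoint_left]
  intro x hx hx'
  simp only [Finset.mem_Iio, Finset.mem_insert, Finset.mem_Ioo] at hx hx'
  grind

theorem prod_univ_split {M : Type*} [CommMonoid M] (i : Fin m) (F : Fin m → M) :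
    ∏ k, F k = (∏ k ∈ Finset.Iio i, F k) * F i * ∏ k ∈ Finset.Ioi i, F k := by
  have h1 : Finset.univ = (insert i (Finset.Iio i)) ∪ Finset.Ioi i := by
    ext x; simp only [Finset.mem_Iio, Finset.mem_union, Finset.mem_insert, Finset.mem_Ioi,
      Finset.mem_univ]; grind
  rw [h1, Finset.prod_union, Finset.prod_insert (by simp), mul_comm (F i)]
  rw [Finset.disjoint_left]
  intro x hx hx'
  simp only [Finset.mem_Iio, Finset.mem_insert, Finset.mem_Ioi] at hx hx'
  grind

/-- Telescoping over the position `k` of the last factor from which the summand `1` is chosen. This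
identity solves the recursions for both families of coefficients. -/
theorem prod_Ioo_add_one {R : Type*} [CommRing R] (x : Fin m → R) (i l : Fin m) :
    ∏ j ∈ Finset.Ioo i l, (x j + 1) = ∏ j ∈ Finset.Ioo i l, x j
      + ∑ k ∈ Finset.Ioo i l, (∏ j ∈ Finset.Ioo i k, (x j + 1)) * ∏ j ∈ Finset.Ioo k l, x j := by
  rw [Finset.prod_add_ordered]
  congr 1
  refine Finset.sum_congr rfl fun k hk => ?_
  have hk := Finset.mem_Ioo.mp hk
  have h1 : (Finset.Ioo i l).filter (· < k) = Finset.Ioo i k := by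
    ext x; simp only [Finset.mem_filter, Finset.mem_Ioo]; grind
  have h2 : (Finset.Ioo i l).filter (k < ·) = Finset.Ioo k l := by
    ext x; simp only [Finset.mem_filter, Finset.mem_Ioo]; grind
  rw [h1, h2, one_mul]

/-! ### Coefficients of the expansions in products of two matrix units -/

/-- The coefficients of the expansion of a raising operator followed by a lowering operator. -/
noncomputable def lowerCoeff (f : MvPolynomial (Fin (m + 1)) ℂ) (i k : Fin m) :
    MvPolynomial (Fin (m + 1)) ℂ :=
  if k < i then 0 else if k = i then diffProd f (Finset.Ioi i)
  else -(diffProd (f - 1) (Finset.Ioo i k) * diffProd f (Finset.Ioi k))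

/-- The coefficients of the expansion of a lowering operator followed by a raising operator. -/
noncomputable def raiseCoeff (f : MvPolynomial (Fin (m + 1)) ℂ) (j k : Fin m) :
    MvPolynomial (Fin (m + 1)) ℂ :=
  if j < k then 0 else if k = j then diffProd f (Finset.Iio j)
  else diffProd (f + 1) (Finset.Ioo k j) * diffProd f (Finset.Iio k)

/-- This is the recursion that commuting `E_{in}` through `lowerAt_rec` imposes on the coefficients;
the closed form satisfies it by `prod_Ioo_add_one` with `x_j = f - 1 - h_j`. -/
theorem lowerCoeff_rec (f : MvPolynomial (Fin (m + 1)) ℂ) (i l : Fin m) :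
    lowerCoeff f i l = (if l = i then diffProd f (Finset.Ioi i) else 0)
      - ∑ k ∈ Finset.Ioi i, lowerCoeff f k l * diffProd f (Finset.Ioo i k) := by
  rcases le_or_gt l i with hl | hl
  · rw [Finset.sum_eq_zero, sub_zero]
    · rcases hl.lt_or_eq with h | h
      · simp [lowerCoeff, h, h.ne]
      · simp [lowerCoeff, h]
    · intro k hk
      rw [lowerCoeff, if_pos (hl.trans_lt (Finset.mem_Ioi.mp hk)), zero_mul]
  · have h1 : Finset.Ioi i = (insert l (Finset.Ioo i l)) ∪ Finset.Ioi l := by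
      ext x; simp only [Finset.mem_Ioi, Finset.mem_union, Finset.mem_insert, Finset.mem_Ioo]; grind
    have h2 : Disjoint (insert l (Finset.Ioo i l)) (Finset.Ioi l) := by
      rw [Finset.disjoint_left]
      intro x hx hx'
      simp only [Finset.mem_Ioi, Finset.mem_insert, Finset.mem_Ioo] at hx hx'
      grind
    have h3 : ∑ k ∈ Finset.Ioi l, lowerCoeff f k l * diffProd f (Finset.Ioo i k) = 0 :=
      Finset.sum_eq_zero fun k hk => by
        rw [lowerCoeff, if_pos (Finset.mem_Ioi.mp hk), zero_mul]
    have h4 : ∑ k ∈ Finset.Ioo i l, lowerCoeff f k l * diffProd f (Finset.Ioo i k)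
        = -((∑ k ∈ Finset.Ioo i l, diffProd f (Finset.Ioo i k) *
          diffProd (f - 1) (Finset.Ioo k l)) * diffProd f (Finset.Ioi l)) := by
      rw [Finset.sum_mul, ← Finset.sum_neg_distrib]
      refine Finset.sum_congr rfl fun k hk => ?_
      have hk := (Finset.mem_Ioo.mp hk).2
      rw [lowerCoeff, if_neg hk.not_gt, if_neg hk.ne']
      ring
    have h5 : diffProd f (Finset.Ioo i l) = diffProd (f - 1) (Finset.Ioo i l)
        + ∑ k ∈ Finset.Ioo i l, diffProd f (Finset.Ioo i k) *
          diffProd (f - 1) (Finset.Ioo k l) := by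
      have := prod_Ioo_add_one (fun j : Fin m => f - 1 - h j.castSucc) i l
      have e : ∀ j : Fin m, f - 1 - h j.castSucc + 1 = f - h j.castSucc := fun j => by ring
      simpa only [e, diffProd] using this
    rw [if_neg hl.ne', h1, Finset.sum_union h2, Finset.sum_insert (by simp), h3, h4]
    simp only [lowerCoeff, if_neg hl.not_gt, if_neg hl.ne', lt_irrefl, if_false, if_true]
    rw [h5]
    ring

theorem raiseCoeff_rec (f : MvPolynomial (Fin (m + 1)) ℂ) (j l : Fin m) :
    raiseCoeff f j l = (if l = j then diffProd f (Finset.Iio j) else 0)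
      + ∑ k ∈ Finset.Iio j, raiseCoeff f k l * diffProd f (Finset.Ioo k j) := by
  rcases le_or_gt j l with hl | hl
  · rw [Finset.sum_eq_zero, add_zero]
    · rcases hl.lt_or_eq with h | h
      · simp [raiseCoeff, h, h.ne']
      · simp [raiseCoeff, h]
    · intro k hk
      rw [raiseCoeff, if_pos ((Finset.mem_Iio.mp hk).trans_le hl), zero_mul]
  · have h1 : Finset.Iio j = (insert l (Finset.Ioo l j)) ∪ Finset.Iio l := by
      ext x; simp only [Finset.mem_Iio, Finset.mem_union, Finset.mem_insert, Finset.mem_Ioo]; grind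
    have h2 : Disjoint (insert l (Finset.Ioo l j)) (Finset.Iio l) := by
      rw [Finset.disjoint_left]
      intro x hx hx'
      simp only [Finset.mem_Iio, Finset.mem_insert, Finset.mem_Ioo] at hx hx'
      grind
    have h3 : ∑ k ∈ Finset.Iio l, raiseCoeff f k l * diffProd f (Finset.Ioo k j) = 0 :=
      Finset.sum_eq_zero fun k hk => by
        rw [raiseCoeff, if_pos (Finset.mem_Iio.mp hk), zero_mul]
    have h4 : ∑ k ∈ Finset.Ioo l j, raiseCoeff f k l * diffProd f (Finset.Ioo k j)
        = (∑ k ∈ Finset.Ioo l j, diffProd (f + 1) (Finset.Ioo l k) *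
          diffProd f (Finset.Ioo k j)) * diffProd f (Finset.Iio l) := by
      rw [Finset.sum_mul]
      refine Finset.sum_congr rfl fun k hk => ?_
      have hk := (Finset.mem_Ioo.mp hk).1
      rw [raiseCoeff, if_neg hk.not_gt, if_neg hk.ne]
      ring
    have h5 : diffProd (f + 1) (Finset.Ioo l j) = diffProd f (Finset.Ioo l j)
        + ∑ k ∈ Finset.Ioo l j, diffProd (f + 1) (Finset.Ioo l k) *
          diffProd f (Finset.Ioo k j) := by
      have := prod_Ioo_add_one (fun k : Fin m => f - h k.castSucc) l j
      have e : ∀ j : Fin m, f - h j.castSucc + 1 = f + 1 - h j.castSucc := fun j => by ring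
      simpa only [e, diffProd] using this
    rw [if_neg hl.ne, h1, Finset.sum_union h2, Finset.sum_insert (by simp), h3, h4]
    simp only [raiseCoeff, if_neg hl.not_gt, if_neg hl.ne, lt_irrefl, if_false, if_true]
    rw [h5]
    ring

theorem diffProd_eq_zero {i : Fin m} {s : Finset (Fin m)} (hi : i ∈ s) :
    diffProd (h i.castSucc) s = 0 :=
  Finset.prod_eq_zero hi (sub_self _)

/-- At `f = h_i` the three cases merge into one product. For `k > i` the factor of index `i` in the
first product is `-1` and accounts for the sign; for `k < i` the factor of index `i` in the second
product is zero. -/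
theorem lowerCoeff_h (i k : Fin m) :
    lowerCoeff (h i.castSucc) i k * diffProd (h i.castSucc - 1) (Finset.Iio i)
      = diffProd (h i.castSucc - 1) (Finset.Iio k) * diffProd (h i.castSucc) (Finset.Ioi k) := by
  rw [lowerCoeff]
  rcases lt_trichotomy k i with hk | hk | hk
  · rw [if_pos hk, diffProd_eq_zero (Finset.mem_Ioi.mpr hk), zero_mul, mul_zero]
  · subst hk
    simp [mul_comm]
  · rw [if_neg hk.not_gt, if_neg hk.ne']
    have : diffProd (h i.castSucc - 1) (Finset.Iio k)
        = diffProd (h i.castSucc - 1) (Finset.Iio i) * (h i.castSucc - 1 - h i.castSucc)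
          * diffProd (h i.castSucc - 1) (Finset.Ioo i k) := prod_Iio_split hk _
    rw [this]
    ring

/-- As for `lowerCoeff_h`, with the factor of index `j` equal to `+1` when `k < j` and zero when `k
> j`. -/
theorem raiseCoeff_h (j k : Fin m) :
    raiseCoeff (h j.castSucc) j k * diffProd (h j.castSucc + 1) (Finset.Ioi j)
      = diffProd (h j.castSucc) (Finset.Iio k) * diffProd (h j.castSucc + 1) (Finset.Ioi k) := by
  rw [raiseCoeff]
  rcases lt_trichotomy j k with hk | hk | hk
  · rw [if_pos hk, diffProd_eq_zero (Finset.mem_Iio.mpr hk), zero_mul, zero_mul]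
  · subst hk
    simp
  · rw [if_neg hk.not_gt, if_neg hk.ne]
    have : diffProd (h j.castSucc + 1) (Finset.Ioi k)
        = diffProd (h j.castSucc + 1) (Finset.Ioo k j) * (h j.castSucc + 1 - h j.castSucc)
          * diffProd (h j.castSucc + 1) (Finset.Ioi j) := prod_Ioi_split hk _
    rw [this]
    ring

theorem shift_neg_diffProd {w : Fin (m + 1) → ℤ} {s : Finset (Fin m)}
    (hw : ∀ k ∈ s, w k.castSucc = 0) (f : MvPolynomial (Fin (m + 1)) ℂ) :
    shift (-w) (diffProd f s) = diffProd (shift (-w) f) s := by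
  rw [diffProd, map_prod, diffProd]
  refine Finset.prod_congr rfl fun k hk => ?_
  rw [map_sub, shift_neg_h k.castSucc, hw k hk, Int.cast_zero, map_zero, add_zero]

/-! ### Leading terms -/

/-- In `lowerAt_rec` the summand for `k > i` is `E_{ki}` applied to an element of height at least `k
+ height ν`, hence negligible modulo `higher m d`. Only the word of length one survives. -/
theorem lowerAt_mul_sub_mem (f : MvPolynomial (Fin (m + 1)) ℂ) (i : Fin m)
    {ν : Fin (m + 1) → ℤ} {u : Ugl m} (hu : u ∈ weightSpace ν) {d : ℤ} (hd : d = i + height ν) :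
    lowerAt f i * u - E (Fin.last m) i.castSucc * u
      * cartan m (shift (-ν) (diffProd f (Finset.Ioi i))) ∈ higher m d := by
  rw [lowerAt_rec, add_mul, mul_assoc _ (cartan m _), cartan_mul_of_mem hu, ← mul_assoc,
    add_sub_cancel_left, Finset.sum_mul]
  refine sum_mem fun k hk => ?_
  rw [mul_assoc, mul_assoc]
  refine E_mul_mem_higher (weightSpace_le_higher ?_ (mul_mem_weightSpace
    (lowerAt_mem_weightSpace f k) (mul_mem_weightSpace (cartan_mem_weightSpace _) hu))) k i
  have := Fin.lt_def.mp (Finset.mem_Ioi.mp hk)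
  rw [zero_add, map_add, height_last_weight]
  omega

theorem raiseAt_mul_sub_mem (f : MvPolynomial (Fin (m + 1)) ℂ) (i : Fin m)
    {ν : Fin (m + 1) → ℤ} {u : Ugl m} (hu : u ∈ weightSpace ν) {d : ℤ} (hd : d = height ν - i) :
    raiseAt f i * u - E i.castSucc (Fin.last m) * u
      * cartan m (shift (-ν) (diffProd f (Finset.Iio i))) ∈ higher m d := by
  rw [raiseAt_rec, add_mul, mul_assoc _ (cartan m _), cartan_mul_of_mem hu, ← mul_assoc,
    add_sub_cancel_left, Finset.sum_mul]
  refine sum_mem fun k hk => ?_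
  rw [mul_assoc, mul_assoc]
  refine E_mul_mem_higher (weightSpace_le_higher ?_ (mul_mem_weightSpace
    (raiseAt_mem_weightSpace f k) (mul_mem_weightSpace (cartan_mem_weightSpace _) hu))) i k
  have := Fin.lt_def.mp (Finset.mem_Iio.mp hk)
  rw [zero_add, map_add, height_weight_last]
  omega

/-- `higher` is stable on the left under `gl_m` only, so an arbitrary `E_{ab}` has to be commuted
past each `E_{ki}`. What is left with `E_{ki}` in front is negligible, and the brackets remain as
corrections. -/
theorem E_mul_lowerAt_sub_mem (f : MvPolynomial (Fin (m + 1)) ℂ) (a b : Fin (m + 1)) (i : Fin m)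
    {d : ℤ} (hd : d = height (weight a b) + i) :
    E a b * lowerAt f i - (E a b * E (Fin.last m) i.castSucc * cartan m (diffProd f (Finset.Ioi i))
      + ∑ k ∈ Finset.Ioi i, ((if b = k.castSucc then E a i.castSucc * lowerAt f k
          * cartan m (diffProd f (Finset.Ioo i k)) else 0)
        - (if i.castSucc = a then E k.castSucc b * lowerAt f k
          * cartan m (diffProd f (Finset.Ioo i k)) else 0))) ∈ higher m d := by
  have h1 : E a b * lowerAt f i
      = E a b * E (Fin.last m) i.castSucc * cartan m (diffProd f (Finset.Ioi i))
      + ∑ k ∈ Finset.Ioi i, (E k.castSucc i.castSucc * (E a b * lowerAt f k)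
          * cartan m (diffProd f (Finset.Ioo i k))
        + ((if b = k.castSucc then E a i.castSucc * lowerAt f k
          * cartan m (diffProd f (Finset.Ioo i k)) else 0)
        - (if i.castSucc = a then E k.castSucc b * lowerAt f k
          * cartan m (diffProd f (Finset.Ioo i k)) else 0))) := by
    conv_lhs => rw [lowerAt_rec, mul_add, Finset.mul_sum]
    congr 1
    · rw [mul_assoc]
    · refine Finset.sum_congr rfl fun k _ => ?_
      rw [← mul_assoc, ← mul_assoc, E_mul_E]
      simp only [sub_mul, add_mul, ite_mul, zero_mul, mul_assoc, add_sub_assoc]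
  rw [h1, Finset.sum_add_distrib, add_sub_add_left_eq_sub, add_sub_cancel_right]
  refine sum_mem fun k hk => mul_cartan_mem_higher (E_mul_mem_higher (weightSpace_le_higher ?_
    (mul_mem_weightSpace (E_mem_weightSpace _ _) (lowerAt_mem_weightSpace f k))) k i) _
  have := Fin.lt_def.mp (Finset.mem_Ioi.mp hk)
  rw [map_add, height_last_weight]
  omega

theorem E_mul_raiseAt_sub_mem (f : MvPolynomial (Fin (m + 1)) ℂ) (a b : Fin (m + 1)) (i : Fin m)
    {d : ℤ} (hd : d = height (weight a b) - i) :
    E a b * raiseAt f i - (E a b * E i.castSucc (Fin.last m) * cartan m (diffProd f (Finset.Iio i))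
      + ∑ k ∈ Finset.Iio i, ((if b = i.castSucc then E a k.castSucc * raiseAt f k
          * cartan m (diffProd f (Finset.Ioo k i)) else 0)
        - (if k.castSucc = a then E i.castSucc b * raiseAt f k
          * cartan m (diffProd f (Finset.Ioo k i)) else 0))) ∈ higher m d := by
  have h1 : E a b * raiseAt f i
      = E a b * E i.castSucc (Fin.last m) * cartan m (diffProd f (Finset.Iio i))
      + ∑ k ∈ Finset.Iio i, (E i.castSucc k.castSucc * (E a b * raiseAt f k)
          * cartan m (diffProd f (Finset.Ioo k i))
        + ((if b = i.castSucc then E a k.castSucc * raiseAt f k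
          * cartan m (diffProd f (Finset.Ioo k i)) else 0)
        - (if k.castSucc = a then E i.castSucc b * raiseAt f k
          * cartan m (diffProd f (Finset.Ioo k i)) else 0))) := by
    conv_lhs => rw [raiseAt_rec, mul_add, Finset.mul_sum]
    congr 1
    · rw [mul_assoc]
    · refine Finset.sum_congr rfl fun k _ => ?_
      rw [← mul_assoc, ← mul_assoc, E_mul_E]
      simp only [sub_mul, add_mul, ite_mul, zero_mul, mul_assoc, add_sub_assoc]
  rw [h1, Finset.sum_add_distrib, add_sub_add_left_eq_sub, add_sub_cancel_right]
  refine sum_mem fun k hk => mul_cartan_mem_higher (E_mul_mem_higher (weightSpace_le_higher ?_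
    (mul_mem_weightSpace (E_mem_weightSpace _ _) (raiseAt_mem_weightSpace f k))) i k) _
  have := Fin.lt_def.mp (Finset.mem_Iio.mp hk)
  rw [map_add, height_weight_last]
  omega

theorem lowering_mul_lowering_mem_of_lt {i j : Fin m} (hij : i < j) :
    lowering i * lowering j - lowering j * lowering i ∈ rootIdeal m := by
  have hne : i.castSucc ≠ j.castSucc := by simp [hij.ne]
  have hl : ∀ k : Fin m, k.castSucc ≠ Fin.last m := fun k => (Fin.castSucc_lt_last k).ne
  have hwi := lowerAt_mem_weightSpace (h i.castSucc) i
  have hwj := lowerAt_mem_weightSpace (h j.castSucc) j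
  refine IsSingular.mem_rootIdeal
    (((isSingular_lowering i).mul (isSingular_lowering j)).sub
      ((isSingular_lowering j).mul (isSingular_lowering i)))
    (sub_mem (mul_mem_weightSpace hwi hwj)
      (by rw [add_comm (weight _ _)]; exact mul_mem_weightSpace hwj hwi)) ?_
  rw [map_add, height_last_weight, height_last_weight, lowering_eq, lowering_eq]
  set D := higher m ((i : ℤ) + j)
  set hi : MvPolynomial (Fin (m + 1)) ℂ := h i.castSucc with hhi
  set hj : MvPolynomial (Fin (m + 1)) ℂ := h j.castSucc with hhj
  have h1 := lowerAt_mul_sub_mem hi i hwj (d := (i : ℤ) + j) (by rw [height_last_weight])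
  have h2 := lowerAt_mul_sub_mem hj j hwi (d := (i : ℤ) + j)
    (by rw [height_last_weight, add_comm])
  -- Needed at `f = h_j` for `z_{ni} z_{nj}`, and at `f = h_i` for the correction term in `z_{nj}
  -- z_{ni}`.
  have h3 : ∀ f, E (Fin.last m) i.castSucc * lowerAt f j - E (Fin.last m) i.castSucc
      * E (Fin.last m) j.castSucc * cartan m (diffProd f (Finset.Ioi j)) ∈ D := by
    intro f
    have := E_mul_lowerAt_sub_mem f (Fin.last m) i.castSucc j (d := (i : ℤ) + j)
      (by rw [height_last_weight])
    rwa [Finset.sum_eq_zero, add_zero] at this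
    intro k hk
    rw [if_neg (hl j), if_neg, sub_zero]
    simpa using (hij.trans (Finset.mem_Ioi.mp hk)).ne
  -- In this order the bracket of `E_{nj}` with `E_{ji}` is nonzero, so a correction `E_{ni} lowerAt
  -- h_i j` survives at `k = j`.
  have h4 := E_mul_lowerAt_sub_mem hi (Fin.last m) j.castSucc i (d := (i : ℤ) + j)
      (by rw [height_last_weight, add_comm])
  simp only [if_neg (hl i), sub_zero, Fin.castSucc_inj] at h4
  rw [Finset.sum_ite_eq, if_pos (Finset.mem_Ioi.mpr hij)] at h4
  have e1 : shift (-weight (Fin.last m) i.castSucc) (diffProd hj (Finset.Ioi j))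
      = diffProd hj (Finset.Ioi j) := by
    rw [shift_neg_diffProd, shift_neg_h j.castSucc, weight_apply, if_neg (hl j), if_neg hne.symm]
    · simp [hhj]
    · intro k hk
      rw [weight_apply, if_neg (hl k), if_neg (by simpa using (hij.trans (Finset.mem_Ioi.mp hk)).ne'),
        sub_zero]
  have e2 : shift (-weight (Fin.last m) j.castSucc) (diffProd hi (Finset.Ioi i))
      = diffProd hi (Finset.Ioo i j) * (hi - hj + 1) * diffProd hi (Finset.Ioi j) := by
    have e3 : shift (-weight (Fin.last m) j.castSucc) hi = hi := by
      rw [hhi, shift_neg_h i.castSucc, weight_apply, if_neg (hl i), if_neg hne]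
      simp
    have e4 : diffProd hi (Finset.Ioi i)
        = diffProd hi (Finset.Ioo i j) * (hi - hj) * diffProd hi (Finset.Ioi j) :=
      prod_Ioi_split hij _
    rw [e4, map_mul, map_mul, shift_neg_diffProd, shift_neg_diffProd, map_sub, e3,
      hhj, shift_neg_h j.castSucc, weight_apply, if_neg (hl j), if_pos rfl]
    · congr 2
      simp
      ring
    · intro k hk
      rw [weight_apply, if_neg (hl k), if_neg (by simpa using (Finset.mem_Ioi.mp hk).ne'),
        sub_zero]
    · intro k hk
      rw [weight_apply, if_neg (hl k), if_neg (by simpa using (Finset.mem_Ioo.mp hk).2.ne),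
        sub_zero]
  have e4 : diffProd hi (Finset.Ioi i)
      = diffProd hi (Finset.Ioo i j) * (hi - hj) * diffProd hi (Finset.Ioi j) :=
    prod_Ioi_split hij _
  have e5 : (E (Fin.last m) j.castSucc * E (Fin.last m) i.castSucc : Ugl m)
      = E (Fin.last m) i.castSucc * E (Fin.last m) j.castSucc := by
    rw [E_mul_E, if_neg (hl j), if_neg (hl i)]; simp
  rw [e1] at h2
  rw [e2] at h1
  rw [e4, e5] at h4
  have k1 := mul_cartan_mem_higher (h3 hj)
    (diffProd hi (Finset.Ioo i j) * (hi - hj + 1) * diffProd hi (Finset.Ioi j))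
  have k2 := mul_cartan_mem_higher h4 (diffProd hj (Finset.Ioi j))
  have k3 := mul_cartan_mem_higher (h3 hi)
    (diffProd hi (Finset.Ioo i j) * diffProd hj (Finset.Ioi j))
  have key := sub_mem (add_mem h1 k1) (add_mem (add_mem h2 k2) k3)
  convert key using 1
  generalize E (Fin.last m) i.castSucc * E (Fin.last m) j.castSucc = e
  -- The factor `h_i - h_j + 1`, shifted by the weight of `z_{nj}`, splits into `h_i - h_j` from the
  -- leading term of `z_{nj} z_{ni}` and `1` from its correction term.
  have e6 : diffProd hj (Finset.Ioi j) *
      (diffProd hi (Finset.Ioo i j) * (hi - hj + 1) * diffProd hi (Finset.Ioi j))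
      = diffProd hi (Finset.Ioo i j) * (hi - hj) * diffProd hi (Finset.Ioi j)
        * diffProd hj (Finset.Ioi j) + diffProd hi (Finset.Ioi j) *
        (diffProd hi (Finset.Ioo i j) * diffProd hj (Finset.Ioi j)) := by ring
  simp only [sub_mul, add_mul, mul_assoc e, ← map_mul, e6]
  simp only [map_mul, map_add, mul_add, mul_assoc]
  abel

theorem lowering_mul_lowering_mem (i j : Fin m) :
    lowering i * lowering j - lowering j * lowering i ∈ rootIdeal m := by
  rcases lt_trichotomy i j with hij | rfl | hij
  · exact lowering_mul_lowering_mem_of_lt hij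
  · simp
  · rw [← neg_sub]
    exact neg_mem (lowering_mul_lowering_mem_of_lt hij)

theorem raising_mul_lowering_mem {i j : Fin m} (hij : i ≠ j) :
    raising i * lowering j - lowering j * raising i ∈ rootIdeal m := by
  have hne : i.castSucc ≠ j.castSucc := by simp [hij]
  have hl : ∀ k : Fin m, k.castSucc ≠ Fin.last m := fun k => (Fin.castSucc_lt_last k).ne
  have hwi := raiseAt_mem_weightSpace (h i.castSucc) i
  have hwj := lowerAt_mem_weightSpace (h j.castSucc) j
  refine IsSingular.mem_rootIdeal
    (((isSingular_raising i).mul (isSingular_lowering j)).sub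
      ((isSingular_lowering j).mul (isSingular_raising i)))
    (sub_mem (mul_mem_weightSpace hwi hwj)
      (by rw [add_comm (weight _ _)]; exact mul_mem_weightSpace hwj hwi)) ?_
  rw [map_add, height_last_weight, height_weight_last, raising_eq, lowering_eq]
  set d : ℤ := -(i : ℤ) + j with hd
  set hi : MvPolynomial (Fin (m + 1)) ℂ := h i.castSucc with hhi
  set hj : MvPolynomial (Fin (m + 1)) ℂ := h j.castSucc with hhj
  have h1 := raiseAt_mul_sub_mem hi i hwj (d := d) (by rw [height_last_weight]; omega)
  have h2 := lowerAt_mul_sub_mem hj j hwi (d := d) (by rw [height_weight_last]; omega)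
  have h3 := E_mul_lowerAt_sub_mem hj i.castSucc (Fin.last m) j (d := d)
      (by rw [height_weight_last])
  rw [Finset.sum_eq_zero (fun k _ => by rw [if_neg (hl k).symm, if_neg hne.symm, sub_zero]),
    add_zero] at h3
  have h4 := E_mul_raiseAt_sub_mem hi (Fin.last m) j.castSucc i (d := d)
      (by rw [height_last_weight]; omega)
  rw [Finset.sum_eq_zero (fun k _ => by rw [if_neg (hl k), if_neg hne.symm, sub_zero]),
    add_zero] at h4
  -- The bracket of `E_{in}` and `E_{nj}` is negligible: it lies in `J'` if `i < j`, and if `i > j`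
  -- it is a lowering element of `gl_m` applied to `1`, whose height `0` exceeds `d = j - i`.
  have h5 : E i.castSucc j.castSucc ∈ higher m d := by
    rcases lt_or_gt_of_ne hij with hlt | hgt
    · exact higher_of_mem (E_mem_rootIdeal hlt)
    · rw [← mul_one (E i.castSucc j.castSucc)]
      refine E_mul_mem_higher ?_ i j
      rw [← map_one (cartan m)]
      refine weightSpace_le_higher ?_ (cartan_mem_weightSpace 1)
      have := Fin.lt_def.mp hgt
      rw [map_zero]
      omega
  have e5 : (E i.castSucc (Fin.last m) * E (Fin.last m) j.castSucc : Ugl m)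
      = E (Fin.last m) j.castSucc * E i.castSucc (Fin.last m) + E i.castSucc j.castSucc := by
    rw [E_mul_E, if_pos rfl, if_neg hne.symm, sub_zero]
  -- For `i < j` neither shift has any effect. For `i > j` each product has one factor involving
  -- both indices, and the identity reduces to `(h_j - h_i)(h_i - h_j + 1) = (h_i - h_j)(h_j - h_i -
  -- 1)`.
  have e1 : diffProd hj (Finset.Ioi j) *
      shift (-weight (Fin.last m) j.castSucc) (diffProd hi (Finset.Iio i))
      = diffProd hi (Finset.Iio i) *
      shift (-weight i.castSucc (Fin.last m)) (diffProd hj (Finset.Ioi j)) := by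
    have s1 : shift (-weight (Fin.last m) j.castSucc) hi = hi := by
      rw [hhi, shift_neg_h i.castSucc, weight_apply, if_neg (hl i), if_neg hne]
      simp
    have s2 : shift (-weight i.castSucc (Fin.last m)) hj = hj := by
      rw [hhj, shift_neg_h j.castSucc, weight_apply, if_neg (hl j), if_neg hne.symm]
      simp
    have s3 : shift (-weight (Fin.last m) j.castSucc) hj = hj - 1 := by
      rw [hhj, shift_neg_h j.castSucc, weight_apply, if_neg (hl j), if_pos rfl]
      simp [sub_eq_add_neg]
    have s4 : shift (-weight i.castSucc (Fin.last m)) hi = hi + 1 := by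
      rw [hhi, shift_neg_h i.castSucc, weight_apply, if_neg (hl i), if_pos rfl]
      simp
    have z1 : ∀ s : Finset (Fin m), j ∉ s →
        shift (-weight (Fin.last m) j.castSucc) (diffProd hi s) = diffProd hi s := by
      intro s hs
      rw [shift_neg_diffProd, s1]
      intro k hk
      rw [weight_apply, if_neg (hl k), if_neg (fun e => hs (by rwa [← Fin.castSucc_injective m e])), sub_zero]
    have z2 : ∀ s : Finset (Fin m), i ∉ s →
        shift (-weight i.castSucc (Fin.last m)) (diffProd hj s) = diffProd hj s := by
      intro s hs
      rw [shift_neg_diffProd, s2]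
      intro k hk
      rw [weight_apply, if_neg (hl k), if_neg (fun e => hs (by rwa [← Fin.castSucc_injective m e])), sub_zero]
    rcases lt_or_gt_of_ne hij with hlt | hgt
    · rw [z1 _ (by simpa using hlt.le), z2 _ (by simpa using hlt.le), mul_comm]
    · have e3 : diffProd hi (Finset.Iio i)
          = diffProd hi (Finset.Iio j) * (hi - hj) * diffProd hi (Finset.Ioo j i) :=
        prod_Iio_split hgt _
      have e4 : diffProd hj (Finset.Ioi j)
          = diffProd hj (Finset.Ioo j i) * (hj - hi) * diffProd hj (Finset.Ioi i) :=
        prod_Ioi_split hgt _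
      rw [e3, e4]
      simp only [map_mul, map_sub, s1, s2, s3, s4]
      rw [z1 _ (by simp), z1 _ (by simp), z2 _ (by simp), z2 _ (by simp)]
      ring
  have k1 := mul_cartan_mem_higher h3
    (shift (-weight (Fin.last m) j.castSucc) (diffProd hi (Finset.Iio i)))
  have k2 := mul_cartan_mem_higher h4
    (shift (-weight i.castSucc (Fin.last m)) (diffProd hj (Finset.Ioi j)))
  have k3 := mul_cartan_mem_higher h5 (diffProd hj (Finset.Ioi j) *
      shift (-weight (Fin.last m) j.castSucc) (diffProd hi (Finset.Iio i)))
  have key := add_mem (sub_mem (add_mem h1 k1) (add_mem h2 k2)) k3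
  convert key using 1
  rw [e5]
  generalize E (Fin.last m) j.castSucc * E i.castSucc (Fin.last m) = e
  simp only [sub_mul, add_mul, mul_assoc, ← map_mul, e1]
  abel

/-! ### The product of a raising and a lowering operator of the same index -/

/-- The corrections in `E_mul_lowerAt_sub_mem` are `-E_{kn} lowerAt f k` with `k > i`, which are
again of the form being expanded; downward induction and `lowerCoeff_rec` finish. -/
theorem E_mul_lowerAt_sum_sub_mem (f : MvPolynomial (Fin (m + 1)) ℂ) (i : Fin m) :
    E i.castSucc (Fin.last m) * lowerAt f i
      - ∑ l, E l.castSucc (Fin.last m) * E (Fin.last m) l.castSucc * cartan m (lowerCoeff f i l)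
      ∈ higher m 0 := by
  induction i using WellFoundedGT.induction with
  | ind i ih =>
  have hl : ∀ k : Fin m, k.castSucc ≠ Fin.last m := fun k => (Fin.castSucc_lt_last k).ne
  have h1 := E_mul_lowerAt_sub_mem f i.castSucc (Fin.last m) i (d := 0)
    (by rw [height_weight_last]; omega)
  simp only [if_neg (hl _).symm, if_true, zero_sub] at h1
  have h2 := (higher m 0).sum_mem fun k (hk : k ∈ Finset.Ioi i) =>
    mul_cartan_mem_higher (ih k (Finset.mem_Ioi.mp hk)) (diffProd f (Finset.Ioo i k))
  have h3 := sub_mem h1 h2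
  convert h3 using 1
  simp only [sub_mul, Finset.sum_sub_distrib, Finset.sum_neg_distrib, Finset.sum_mul]
  rw [Finset.sum_comm (s := Finset.Ioi i)]
  have h4 : ∀ l : Fin m, E l.castSucc (Fin.last m) * E (Fin.last m) l.castSucc *
      cartan m (lowerCoeff f i l)
      = (if l = i then E i.castSucc (Fin.last m) * E (Fin.last m) i.castSucc
          * cartan m (diffProd f (Finset.Ioi i)) else 0)
        - ∑ k ∈ Finset.Ioi i, E l.castSucc (Fin.last m) * E (Fin.last m) l.castSucc *
          cartan m (lowerCoeff f k l) * cartan m (diffProd f (Finset.Ioo i k)) := by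
    intro l
    rw [lowerCoeff_rec, map_sub, mul_sub, map_sum, Finset.mul_sum]
    simp only [map_mul, mul_assoc]
    congr 1
    split_ifs with h
    · rw [h]
    · simp
  rw [Finset.sum_congr rfl fun l _ => h4 l, Finset.sum_sub_distrib, Finset.sum_ite_eq',
    if_pos (Finset.mem_univ i)]
  abel

theorem E_mul_raiseAt_sum_sub_mem (f : MvPolynomial (Fin (m + 1)) ℂ) (j : Fin m) :
    E (Fin.last m) j.castSucc * raiseAt f j
      - ∑ l, E (Fin.last m) l.castSucc * E l.castSucc (Fin.last m) * cartan m (raiseCoeff f j l)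
      ∈ higher m 0 := by
  induction j using WellFoundedLT.induction with
  | ind j ih =>
  have hl : ∀ k : Fin m, k.castSucc ≠ Fin.last m := fun k => (Fin.castSucc_lt_last k).ne
  have h1 := E_mul_raiseAt_sub_mem f (Fin.last m) j.castSucc j (d := 0)
    (by rw [height_last_weight]; omega)
  simp only [if_neg (hl _), if_true, sub_zero] at h1
  have h2 := (higher m 0).sum_mem fun k (hk : k ∈ Finset.Iio j) =>
    mul_cartan_mem_higher (ih k (Finset.mem_Iio.mp hk)) (diffProd f (Finset.Ioo k j))
  have h3 := add_mem h1 h2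
  convert h3 using 1
  simp only [sub_mul, Finset.sum_sub_distrib, Finset.sum_mul]
  rw [Finset.sum_comm (s := Finset.Iio j)]
  have h4 : ∀ l : Fin m, E (Fin.last m) l.castSucc * E l.castSucc (Fin.last m) *
      cartan m (raiseCoeff f j l)
      = (if l = j then E (Fin.last m) j.castSucc * E j.castSucc (Fin.last m)
          * cartan m (diffProd f (Finset.Iio j)) else 0)
        + ∑ k ∈ Finset.Iio j, E (Fin.last m) l.castSucc * E l.castSucc (Fin.last m) *
          cartan m (raiseCoeff f k l) * cartan m (diffProd f (Finset.Ioo k j)) := by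
    intro l
    rw [raiseCoeff_rec, map_add, mul_add, map_sum, Finset.mul_sum]
    simp only [map_mul, mul_assoc]
    congr 1
    split_ifs with h
    · rw [h]
    · simp
  rw [Finset.sum_congr rfl fun l _ => h4 l, Finset.sum_add_distrib, Finset.sum_ite_eq',
    if_pos (Finset.mem_univ j)]
  abel

theorem raising_mul_lowering_sub_mem (i : Fin m) :
    raising i * lowering i
      - ∑ k, E k.castSucc (Fin.last m) * E (Fin.last m) k.castSucc
        * cartan m (diffProd (h i.castSucc - 1) (Finset.Iio k)
          * diffProd (h i.castSucc) (Finset.Ioi k)) ∈ higher m 0 := by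
  have hl : ∀ k : Fin m, k.castSucc ≠ Fin.last m := fun k => (Fin.castSucc_lt_last k).ne
  have h1 := raiseAt_mul_sub_mem (h i.castSucc) i (lowerAt_mem_weightSpace (h i.castSucc) i)
    (d := 0) (by rw [height_last_weight]; omega)
  have h2 := mul_cartan_mem_higher (E_mul_lowerAt_sum_sub_mem (h i.castSucc) i)
    (diffProd (h i.castSucc - 1) (Finset.Iio i))
  have e1 : shift (-weight (Fin.last m) i.castSucc) (diffProd (h i.castSucc) (Finset.Iio i))
      = diffProd (h i.castSucc - 1) (Finset.Iio i) := by
    rw [shift_neg_diffProd, shift_neg_h i.castSucc, weight_apply, if_neg (hl i), if_pos rfl]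
    · simp [sub_eq_add_neg]
    · intro k hk
      rw [weight_apply, if_neg (hl k), if_neg (by simpa using (Finset.mem_Iio.mp hk).ne), sub_zero]
  rw [e1] at h1
  have h3 := add_mem h1 h2
  rw [sub_mul, sub_add_sub_cancel, Finset.sum_mul] at h3
  simpa only [raising_eq, lowering_eq, mul_assoc _ (cartan m _), ← map_mul, lowerCoeff_h] using h3

theorem lowering_mul_raising_sub_mem (j : Fin m) :
    lowering j * raising j
      - ∑ k, E (Fin.last m) k.castSucc * E k.castSucc (Fin.last m)
        * cartan m (diffProd (h j.castSucc) (Finset.Iio k)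
          * diffProd (h j.castSucc + 1) (Finset.Ioi k)) ∈ higher m 0 := by
  have hl : ∀ k : Fin m, k.castSucc ≠ Fin.last m := fun k => (Fin.castSucc_lt_last k).ne
  have h1 := lowerAt_mul_sub_mem (h j.castSucc) j (raiseAt_mem_weightSpace (h j.castSucc) j)
    (d := 0) (by rw [height_weight_last]; omega)
  have h2 := mul_cartan_mem_higher (E_mul_raiseAt_sum_sub_mem (h j.castSucc) j)
    (diffProd (h j.castSucc + 1) (Finset.Ioi j))
  have e1 : shift (-weight j.castSucc (Fin.last m)) (diffProd (h j.castSucc) (Finset.Ioi j))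
      = diffProd (h j.castSucc + 1) (Finset.Ioi j) := by
    rw [shift_neg_diffProd, shift_neg_h j.castSucc, weight_apply, if_neg (hl j), if_pos rfl]
    · simp
    · intro k hk
      rw [weight_apply, if_neg (hl k), if_neg (by simpa using (Finset.mem_Ioi.mp hk).ne'), sub_zero]
  rw [e1] at h1
  have h3 := add_mem h1 h2
  rw [sub_mul, sub_add_sub_cancel, Finset.sum_mul] at h3
  simpa only [raising_eq, lowering_eq, mul_assoc _ (cartan m _), ← map_mul, raiseCoeff_h] using h3

/-! ### Two identities -/

/-- Telescoping: the constant term of the product of a raising and a lowering operator. -/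
theorem sum_mul_prod_eq {R : Type*} [CommRing R] (x : Fin m → R) (y : R) {i : Fin m}
    (hi : x i = 0) :
    ∑ k : Fin m, (y - x k + ((k : ℕ) : R) - (m : R))
      * ((∏ j ∈ Finset.Iio k, (x j - 1)) * ∏ j ∈ Finset.Ioi k, x j)
      = (∏ j ∈ Finset.univ.erase i, (x j - 1)) * (y - 1) := by
  let B : ℕ → R := fun k => ∏ j : Fin m, if (j : ℕ) < k then x j - 1 else x j
  -- `B k` has its first `k` factors lowered by one. The linear factor is chosen so that `F k - F (k
  -- + 1)` is the `k`-th summand; `F 0` vanishes since `x i = 0`, and in `F m` the factor `x i - 1 =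
  -- -1` fixes the sign.
  let F : ℕ → R := fun k => (y - 1 - m + k) * B k
  have hB : ∀ k : Fin m, ∀ n : ℕ, (n = k ∨ n = k + 1) → B n = (∏ j ∈ Finset.Iio k, (x j - 1))
      * (if (k : ℕ) < n then x k - 1 else x k) * ∏ j ∈ Finset.Ioi k, x j := by
    intro k n hn
    simp only [B]
    rw [prod_univ_split k]
    congr 1
    · congr 1
      refine Finset.prod_congr rfl fun j hj => if_pos ?_
      have := Fin.lt_def.mp (Finset.mem_Iio.mp hj)
      omega
    · refine Finset.prod_congr rfl fun j hj => if_neg ?_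
      have := Fin.lt_def.mp (Finset.mem_Ioi.mp hj)
      omega
  have hF : ∀ k : Fin m, (y - x k + ((k : ℕ) : R) - (m : R))
      * ((∏ j ∈ Finset.Iio k, (x j - 1)) * ∏ j ∈ Finset.Ioi k, x j) = F k - F (k + 1) := by
    intro k
    simp only [F]
    rw [hB k k (Or.inl rfl), hB k (k + 1) (Or.inr rfl), if_neg (lt_irrefl _),
      if_pos (Nat.lt_succ_self _)]
    push_cast
    ring
  rw [Finset.sum_congr rfl fun k _ => hF k, Fin.sum_univ_eq_sum_range (fun k => F k - F (k + 1)),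
    Finset.sum_range_sub']
  have h0 : B 0 = 0 := Finset.prod_eq_zero (Finset.mem_univ i) (by simp [hi])
  have hm : B m = ∏ j, (x j - 1) := Finset.prod_congr rfl fun j _ => if_pos j.2
  simp only [F]
  rw [h0, hm, ← Finset.mul_prod_erase _ _ (Finset.mem_univ i), hi]
  ring

/-- Lagrange interpolation of a monic product of degree `m - 1`. -/
theorem lagrange_prod {K : Type*} [Field K] (y : Fin m → K) (hy : Function.Injective y)
    (k : Fin m) (x : K) :
    (∏ l ∈ Finset.Iio k, (x - y l)) * ∏ l ∈ Finset.Ioi k, (x + 1 - y l)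
      = ∑ j, ((∏ l ∈ Finset.Iio k, (y j - y l)) * ∏ l ∈ Finset.Ioi k, (y j + 1 - y l))
        * ∏ l ∈ Finset.univ.erase j, (x - y l) / (y j - y l) := by
  -- A product of `m - 1` linear factors, hence determined by its values at the `m` distinct nodes
  -- `y j`.
  let P : Polynomial K := (∏ l ∈ Finset.Iio k, (Polynomial.X - Polynomial.C (y l)))
    * ∏ l ∈ Finset.Ioi k, (Polynomial.X - Polynomial.C (y l - 1))
  have hP : ∀ z, P.eval z
      = (∏ l ∈ Finset.Iio k, (z - y l)) * ∏ l ∈ Finset.Ioi k, (z + 1 - y l) := by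
    intro z
    simp only [P, Polynomial.eval_mul, Polynomial.eval_prod, Polynomial.eval_sub,
      Polynomial.eval_X, Polynomial.eval_C]
    congr 1
    exact Finset.prod_congr rfl fun l _ => by ring
  have hdeg : P.degree < (Finset.univ : Finset (Fin m)).card := by
    have hk := k.2
    rw [Polynomial.degree_mul, Polynomial.degree_prod, Polynomial.degree_prod]
    simp only [Polynomial.degree_X_sub_C, Finset.sum_const, Fin.card_Iio, Fin.card_Ioi,
      Finset.card_univ, Fintype.card_fin, nsmul_eq_mul, mul_one]
    norm_cast
    omega
  have h1 := Lagrange.eq_interpolate (v := y) hy.injOn hdeg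
  have h2 := congrArg (Polynomial.eval x) h1
  rw [Lagrange.interpolate_apply, Polynomial.eval_finsetSum, hP] at h2
  rw [h2]
  refine Finset.sum_congr rfl fun j _ => ?_
  rw [Polynomial.eval_mul, Polynomial.eval_C, hP, Lagrange.basis, Polynomial.eval_prod]
  congr 1
  refine Finset.prod_congr rfl fun l _ => ?_
  rw [Lagrange.basisDivisor, Polynomial.eval_mul, Polynomial.eval_C, Polynomial.eval_sub,
    Polynomial.eval_X, Polynomial.eval_C, div_eq_inv_mul]

theorem hFrac_injective : Function.Injective (hFrac (m := m)) := by
  intro i j hij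
  have h1 := IsFractionRing.injective (Uh m) (Rh m) hij
  by_contra hne
  have h2 := congrArg (MvPolynomial.pderiv i) h1
  simp [MvPolynomial.pderiv_X, Ne.symm hne] at h2

/-- The polynomial `h_i`, as an element of `U(𝔥)`. -/
noncomputable def hSub (i : Fin m) : Uh m := MvPolynomial.X i - MvPolynomial.C ((i : ℕ) : ℂ)

theorem rename_hSub (i : Fin m) : MvPolynomial.rename Fin.castSucc (hSub i) = h i.castSucc := by
  simp [hSub, h]

theorem algebraMap_hSub (i : Fin m) : algebraMap (Uh m) (Rh m) (hSub i) = hFrac i := rfl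

/-- The coefficients of the `z_{nj} z_{jn}` in the expansion of `z_{in} z_{ni}`. -/
noncomputable def exchangeCoeff (i j : Fin m) : Rh m :=
  ∏ k ∈ Finset.univ.erase j, (hFrac i - hFrac k - 1) / (hFrac j - hFrac k)

/-- Interpolation at the nodes `h_j`, evaluated at `h_i - 1`. The basis polynomials take the values
`exchangeCoeff i j`, and `g` is a common denominator that brings the identity back to polynomials.
-/
theorem coeff_identity {i : Fin m} {g : Uh m} {p : Fin m → Uh m}
    (hp : ∀ j, algebraMap (Uh m) (Rh m) (p j) = algebraMap _ _ g * exchangeCoeff i j)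
    (k : Fin m) :
    diffProd (h i.castSucc - 1) (Finset.Iio k) * diffProd (h i.castSucc) (Finset.Ioi k)
        * MvPolynomial.rename Fin.castSucc g
      = ∑ j : Fin m, diffProd (h j.castSucc) (Finset.Iio k)
          * diffProd (h j.castSucc + 1) (Finset.Ioi k)
          * MvPolynomial.rename Fin.castSucc (p j) := by
  have h1 : ((∏ l ∈ Finset.Iio k, (hSub i - 1 - hSub l)) * ∏ l ∈ Finset.Ioi k, (hSub i - hSub l))
      * g = ∑ j : Fin m, ((∏ l ∈ Finset.Iio k, (hSub j - hSub l))
        * ∏ l ∈ Finset.Ioi k, (hSub j + 1 - hSub l)) * p j := by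
    apply IsFractionRing.injective (Uh m) (Rh m)
    simp only [map_mul, map_sum, map_prod, map_sub, map_add, map_one, algebraMap_hSub, hp]
    have := lagrange_prod hFrac hFrac_injective k (hFrac i - 1)
    rw [sub_add_cancel] at this
    rw [this, Finset.sum_mul]
    refine Finset.sum_congr rfl fun j _ => ?_
    rw [exchangeCoeff, mul_assoc, mul_comm (algebraMap _ _ g)]
    simp only [sub_right_comm]
  have h2 := congrArg (MvPolynomial.rename Fin.castSucc) h1
  simpa only [map_mul, map_sum, map_prod, map_sub, map_add, map_one, rename_hSub, diffProd] using h2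

/-- The linear factor on the left is `E_{kk} - E_{nn}` written through the `h`'s, so the sum is what
the commutators `[E_{kn}, E_{nk}]` contribute. It telescopes by `sum_mul_prod_eq` with `x_k = h_i -
h_k` and `y = h_i - h_n`. -/
theorem const_identity (i : Fin m) :
    ∑ k : Fin m, (h k.castSucc - h (Fin.last m) + ((k : ℕ) : MvPolynomial (Fin (m + 1)) ℂ)
        - (m : MvPolynomial (Fin (m + 1)) ℂ))
      * (diffProd (h i.castSucc - 1) (Finset.Iio k) * diffProd (h i.castSucc) (Finset.Ioi k))
      = ∏ j ∈ Finset.univ.erase i.castSucc, (h i.castSucc - h j - 1) := by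
  have h1 := sum_mul_prod_eq (fun k : Fin m => h i.castSucc - h k.castSucc)
    (h i.castSucc - h (Fin.last m)) (sub_self (h i.castSucc))
  have h2 : (Finset.univ : Finset (Fin (m + 1))).erase i.castSucc
      = insert (Fin.last m) ((Finset.univ.erase i).map Fin.castSuccEmb) := by
    ext x
    induction x using Fin.lastCases with
    | last => simp [(Fin.castSucc_lt_last i).ne']
    | cast j => simp [(Fin.castSucc_lt_last j).ne]
  have h3 : ∏ j ∈ Finset.univ.erase i.castSucc, (h i.castSucc - h j - 1)
      = (∏ j ∈ Finset.univ.erase i, (h i.castSucc - h j.castSucc - 1))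
        * (h i.castSucc - h (Fin.last m) - 1) := by
    rw [h2, Finset.prod_insert (by simp [(Fin.castSucc_lt_last _).ne]), Finset.prod_map, mul_comm]
    rfl
  have h4 : ∀ k : Fin m, diffProd (h i.castSucc - 1) (Finset.Iio k)
      = ∏ j ∈ Finset.Iio k, (h i.castSucc - h j.castSucc - 1) := fun k =>
    Finset.prod_congr rfl fun l _ => sub_right_comm _ _ _
  rw [h3, ← h1]
  refine Finset.sum_congr rfl fun k _ => ?_
  rw [h4, diffProd, sub_sub_sub_cancel_left]

/-! ### The exchange relation between raising and lowering operators of equal index -/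

theorem cartanSub_eq (f : Uh m) :
    cartanSub m f = cartan m (MvPolynomial.rename Fin.castSucc f) := rfl

/-- The third relation multiplied on the right by a common denominator `g`, so that everything lies
in `U(gl_n)` and the vanishing criterion applies at weight zero. -/
theorem exchange_mem {i : Fin m} {g : Uh m} {p : Fin m → Uh m}
    (hp : ∀ j, algebraMap (Uh m) (Rh m) (p j) = algebraMap _ _ g * exchangeCoeff i j) :
    (raising i * lowering i - cartan m (∏ j ∈ Finset.univ.erase i.castSucc,
        (h i.castSucc - h j - 1))) * cartanSub m g
      - ∑ j, lowering j * raising j * cartanSub m (p j) ∈ rootIdeal m := by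
  have hl : ∀ k : Fin m, k.castSucc ≠ Fin.last m := fun k => (Fin.castSucc_lt_last k).ne
  have hw : ∀ j : Fin m, weight (Fin.last m) j.castSucc + weight j.castSucc (Fin.last m) = 0 := by
    intro j; simp [weight]
  have hw' : ∀ j : Fin m, weight j.castSucc (Fin.last m) + weight (Fin.last m) j.castSucc = 0 := by
    intro j; simp [weight]
  refine IsSingular.mem_rootIdeal (ν := 0) ?_ ?_ ?_
  · exact ((((isSingular_raising i).mul (isSingular_lowering i)).sub (isSingular_cartan _)).mul
      (isSingular_cartan _)).sub (IsSingular.sum fun j _ =>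
        ((isSingular_lowering j).mul (isSingular_raising j)).mul (isSingular_cartan _))
  · refine sub_mem (mul_cartan_mem_weightSpace (sub_mem ?_ (cartan_mem_weightSpace _)) _)
      (sum_mem fun j _ => mul_cartan_mem_weightSpace ?_ _)
    · rw [← hw' i]
      exact mul_mem_weightSpace (raiseAt_mem_weightSpace _ _) (lowerAt_mem_weightSpace _ _)
    · rw [← hw j]
      exact mul_mem_weightSpace (lowerAt_mem_weightSpace _ _) (raiseAt_mem_weightSpace _ _)
  · rw [map_zero]
    have h1 := mul_cartan_mem_higher (raising_mul_lowering_sub_mem i)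
      (MvPolynomial.rename Fin.castSucc g)
    have h2 := (higher m 0).sum_mem fun j (_ : j ∈ Finset.univ) =>
      mul_cartan_mem_higher (lowering_mul_raising_sub_mem j)
        (MvPolynomial.rename Fin.castSucc (p j))
    have h3 := sub_mem h1 h2
    convert h3 using 1
    -- The offset `k - m` appears because `h_k` and `h_n` are `E_{kk}` and `E_{nn}` lowered by `k`
    -- and `m` in zero-based indexing.
    have e1 : ∀ k : Fin m, (E k.castSucc (Fin.last m) * E (Fin.last m) k.castSucc : Ugl m)
        = E (Fin.last m) k.castSucc * E k.castSucc (Fin.last m)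
          + cartan m (h k.castSucc - h (Fin.last m) + ((k : ℕ) : MvPolynomial (Fin (m + 1)) ℂ)
            - (m : MvPolynomial (Fin (m + 1)) ℂ)) := by
      intro k
      rw [E_mul_E, if_pos rfl, if_pos rfl]
      simp only [map_sub, map_add, cartan_h, map_natCast, Fin.val_castSucc, Fin.val_last]
      abel
    have e2 : ∑ k : Fin m, E k.castSucc (Fin.last m) * E (Fin.last m) k.castSucc
        * cartan m (diffProd (h i.castSucc - 1) (Finset.Iio k)
          * diffProd (h i.castSucc) (Finset.Ioi k))
        = (∑ k : Fin m, E (Fin.last m) k.castSucc * E k.castSucc (Fin.last m)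
          * cartan m (diffProd (h i.castSucc - 1) (Finset.Iio k)
          * diffProd (h i.castSucc) (Finset.Ioi k)))
          + cartan m (∏ j ∈ Finset.univ.erase i.castSucc, (h i.castSucc - h j - 1)) := by
      rw [← const_identity, map_sum, ← Finset.sum_add_distrib]
      refine Finset.sum_congr rfl fun k _ => ?_
      rw [e1, add_mul, ← map_mul (cartan m) (_ - _)]
    have e3 : (∑ k : Fin m, E (Fin.last m) k.castSucc * E k.castSucc (Fin.last m)
          * cartan m (diffProd (h i.castSucc - 1) (Finset.Iio k)
          * diffProd (h i.castSucc) (Finset.Ioi k))) * cartan m (MvPolynomial.rename Fin.castSucc g)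
        = ∑ j : Fin m, (∑ k : Fin m, E (Fin.last m) k.castSucc * E k.castSucc (Fin.last m)
        * cartan m (diffProd (h j.castSucc) (Finset.Iio k)
          * diffProd (h j.castSucc + 1) (Finset.Ioi k)))
          * cartan m (MvPolynomial.rename Fin.castSucc (p j)) := by
      simp only [Finset.sum_mul]
      rw [Finset.sum_comm]
      refine Finset.sum_congr rfl fun k _ => ?_
      rw [mul_assoc, ← map_mul, coeff_identity hp, map_sum, Finset.mul_sum]
      refine Finset.sum_congr rfl fun j _ => ?_
      simp only [map_mul, mul_assoc]
    simp only [sub_mul, Finset.sum_sub_distrib, cartanSub_eq]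
    rw [e2, add_mul, e3]
    abel

theorem exchange_ext_mem (i : Fin m) :
    toExt m (raising i * lowering i) - (toExt m (cartan m (∏ j ∈ Finset.univ.erase i.castSucc,
        (h i.castSucc - h j - 1)))
      + ∑ j, toExt m (lowering j * raising j) * fracExt m (exchangeCoeff i j)) ∈ idealJ m := by
  obtain ⟨g, hg⟩ := IsLocalization.exist_integer_multiples (nonZeroDivisors (Uh m)) Finset.univ
    (fun j => (exchangeCoeff i j : Rh m))
  choose p hp using fun j => hg j (Finset.mem_univ j)
  have hg0 : algebraMap (Uh m) (Rh m) g ≠ 0 := by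
    rw [Ne, FaithfulSMul.algebraMap_eq_zero_iff]
    exact nonZeroDivisors.coe_ne_zero g
  have h1 := exchange_mem (i := i) (g := g) (p := p) fun j => by
    rw [hp j, Algebra.smul_def]
  -- Multiplication by `g⁻¹` on the right keeps the cleared relation inside `J'` and restores the
  -- fractions.
  have h2 := fracExt_mem_leftNormalizer (algebraMap (Uh m) (Rh m) g)⁻¹ _ h1
  convert h2 using 1
  have e1 : ∀ j, fracExt m (exchangeCoeff i j) = toExt m (cartanSub m (p j))
      * fracExt m (algebraMap (Uh m) (Rh m) g)⁻¹ := by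
    intro j
    rw [← fracExt_algebraMap, ← map_mul, hp j, Algebra.smul_def, mul_right_comm,
      mul_inv_cancel₀ hg0, one_mul]
  have e2 : toExt m (cartanSub m g) * fracExt m (algebraMap (Uh m) (Rh m) g)⁻¹ = 1 := by
    rw [← fracExt_algebraMap, ← map_mul, mul_inv_cancel₀ hg0, map_one]
  rw [map_sub, map_mul _ (_ - _), map_sum, sub_mul, mul_assoc, e2, mul_one, map_sub,
    Finset.sum_mul, sub_sub]
  congr 2
  refine Finset.sum_congr rfl fun j _ => ?_
  rw [e1, map_mul _ _ (cartanSub m (p j)), mul_assoc]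

theorem MZ.mk_eq_mk_of_sub_mem {u v : leftNormalizer (idealJ m)}
    (huv : (u : UglExt m) - v ∈ idealJ m) :
    Ideal.Quotient.mk (idealInNormalizer (idealJ m)) u = Ideal.Quotient.mk _ v :=
  Ideal.Quotient.eq.mpr huv

end MickelssonZhelobenko

theorem proposition2p10 (m : ℕ) :
    ∃ (hr : ∀ i : Fin m, MickelssonZhelobenko.toExt m (MickelssonZhelobenko.raising i) ∈
        MickelssonZhelobenko.leftNormalizer (MickelssonZhelobenko.idealJ m))
      (hl : ∀ i : Fin m, MickelssonZhelobenko.toExt m (MickelssonZhelobenko.lowering i) ∈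
        MickelssonZhelobenko.leftNormalizer (MickelssonZhelobenko.idealJ m)),
      let zr : Fin m → MickelssonZhelobenko.MZ m :=
        fun i => MickelssonZhelobenko.MZ.mk _ (hr i)
      let zl : Fin m → MickelssonZhelobenko.MZ m :=
        fun i => MickelssonZhelobenko.MZ.mk _ (hl i)
      (∀ i j : Fin m, zl i * zl j = zl j * zl i) ∧
      (∀ i j : Fin m, i ≠ j → zr i * zl j = zl j * zr i) ∧
      (∀ i : Fin m, zr i * zl i =
        MickelssonZhelobenko.MZ.cartan m (∏ j ∈ Finset.univ.erase i.castSucc,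
          (MickelssonZhelobenko.h i.castSucc - MickelssonZhelobenko.h j - 1)) +
        ∑ j : Fin m, zl j * zr j *
          MickelssonZhelobenko.MZ.frac m (∏ k ∈ Finset.univ.erase j,
            (MickelssonZhelobenko.hFrac i - MickelssonZhelobenko.hFrac k - 1) /
              (MickelssonZhelobenko.hFrac j - MickelssonZhelobenko.hFrac k))) := by
  open MickelssonZhelobenko in
  refine ⟨fun i => mem_leftNormalizer_of_mul_mem (isSingular_raising i),
    fun i => mem_leftNormalizer_of_mul_mem (isSingular_lowering i), ?_, ?_, ?_⟩
  · intro i j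
    refine MZ.mk_eq_mk_of_sub_mem (u := ⟨_, _⟩ * ⟨_, _⟩) (v := ⟨_, _⟩ * ⟨_, _⟩) ?_
    have := lowering_mul_lowering_mem i j
    rwa [mem_rootIdeal, map_sub, map_mul, map_mul] at this
  · intro i j hij
    refine MZ.mk_eq_mk_of_sub_mem (u := ⟨_, _⟩ * ⟨_, _⟩) (v := ⟨_, _⟩ * ⟨_, _⟩) ?_
    have := raising_mul_lowering_mem hij
    rwa [mem_rootIdeal, map_sub, map_mul, map_mul] at this
  · intro i
    have key := exchange_ext_mem i
    simp only [MZ.mk, MZ.cartan, MZ.frac, RingHom.comp_apply, ← map_mul, ← map_sum, ← map_add]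
    refine MZ.mk_eq_mk_of_sub_mem ?_
    simp only [map_mul] at key
    simpa [exchangeCoeff] using key
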